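/- **Model.** Base stations (BSs) are the points $X_i$, $i\in\mathbb N$, of a homogeneous Poisson point process $\Phi=\sum_{i}\delta_{X_i}$ on $\mathbb R^2$ with intensity $\lambda\in(0,\infty)$. The fading variables $H_{i,t}$, $i\in\mathbb N$, $t\in\mathbb N_0$, are i.i.d. exponential with mean $1$; let $\beta>2$ and let $\sigma^2\ge 0$ be the noise power. A user located at $u\in\mathbb R^2$ at slot $t$ and served by the BS at $X_i$ has the instantaneous downlink data rate $$\xi_{u,i}(t)=\log\bigl(1+\mathrm{SINR}_{u,i}(t)\bigr),\qquad \mathrm{SINR}_{u,i}(t)=\frac{H_{i,t}\|X_i-u\|^{-\beta}}{\sum_{j\ne i}H_{j,t}\|X_j-u\|^{-\beta}+\sigma^2}.$$ Let $B(u)$ be the index of the point of $\Phi$ nearest to $u$. Fix an integer cycle length $s\ge1$ and let $Y_1,Y_2,\dots$ be i.i.d. random vectors in $\mathbb R^2$. The moving user starts at $S(0)=0$ and has $$S(t)=\sum_{k=1}^nY_k+\frac{t-ns}{s}\,Y_{n+1},\qquad t=ns,\,ns+1,\dots,(n+1)s,\ n\in\mathbb N_0.$$ The fading variables are independent of $\bigl((X_i)_i,(Y_k)_k\bigr)$,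 and $\Phi$ is independent of $(Y_k)_k$. **Proposition.** Suppose that the moving user is always served by its nearest BS (no handover skipping). Then, at every slot, its instantaneous rate is almost surely well defined (there is a unique nearest BS, the interference series converges, and interference plus noise is positive) and has finite expectation, the expected downlink data rate $$\mathcal T^{(0)}=\lim_{m\to\infty}\frac1m\,\mathbb E\Bigl[\sum_{t=0}^{m-1}\xi_{S(t),B(S(t))}(t)\Bigr]$$ exists, and it equals the expected rate of a static user: for every $u\in\mathbb R^2$ and every slot $t$, $\xi_{u,B(u)}(t)$ is integrable and $\mathcal T^{(0)}=\mathbb E[\xi_{u,B(u)}(t)]$ (in particular $\mathcal T^{(0)}=\mathbb E[\xi_{0,B(0)}(0)]$). Moreover $$\mathcal T^{(0)}=\int_0^\infty\!\!\int_0^\infty\frac{\rho(z,w)}{1+z}\,\mathrm dz\,\mathrm dw,$$ where $$\rho(z,w)=\exp\biggl(-\sigma^2z\Bigl(\frac{w}{\pi\lambda}\Bigr)^{\beta/2}-w\Bigl(1+\frac{2z^{2/\beta}}{\beta}\int_{1/z}^\infty\frac{v^{2/\beta-1}}{1+v}\,\mathrm dv\Bigr)\biggr),$$ and all the integrals in this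 formula converge. -/

import Mathlib

open MeasureTheory ProbabilityTheory Filter Topology Set
open scoped ENNReal NNReal

namespace CellularNetwork

/-- The Euclidean plane. -/
abbrev Plane : Type := EuclideanSpace ℝ (Fin 2)

/-- A Poisson point process on a measurable space, as a random measure `Φ`, with intensity
measure `Λ`: the number of points in a measurable set of finite intensity is Poisson
distributed with parameter `Λ B`, and the numbers of points in finitely many pairwise disjoint
measurable sets are mutually independent. -/
structure IsPoissonPointProcess {Ω E : Type*} [MeasurableSpace Ω] [MeasurableSpace E]
    (Φ : Ω → Measure E) (Λ : Measure E) (P : Measure Ω) : Prop where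
  measurable : Measurable Φ
  hasLaw_count : ∀ B : Set E, MeasurableSet B → Λ B < ∞ →
    HasLaw (fun ω => Φ ω B)
      ((poissonMeasure (Λ B).toNNReal).map (fun k : ℕ => (k : ℝ≥0∞))) P
  iIndepFun_count : ∀ (n : ℕ) (B : Fin n → Set E), (∀ i, MeasurableSet (B i)) →
    Pairwise (fun i j => Disjoint (B i) (B j)) → iIndepFun (fun i ω => Φ ω (B i)) P

/-- The counting measure `∑ i, δ_{x i}` of a sequence of points. -/
noncomputable def pointMeasure (x : ℕ → Plane) : Measure Plane :=
  Measure.sum fun i => Measure.dirac (x i)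

/-- The base station with index `i` is the (strictly) nearest one to the location `u`. -/
def IsNearest (x : ℕ → Plane) (u : Plane) (i : ℕ) : Prop :=
  ∀ j, j ≠ i → ‖x i - u‖ < ‖x j - u‖

/-- The index `B(u)` of the nearest base station to `u`. There is at most one such index; the
value is `0` if there is none. -/
noncomputable def nearestIndex (x : ℕ → Plane) (u : Plane) : ℕ :=
  sInf {i | IsNearest x u i}

/-- Power received at `u` from the base station `i`, with fading variables `h` and path-loss
exponent `β`. -/
noncomputable def receivedPower (β : ℝ) (x : ℕ → Plane) (h : ℕ → ℝ) (u : Plane) (i : ℕ) : ℝ :=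
  h i * ‖x i - u‖ ^ (-β)

/-- Total interference power at `u` when served by the base station `i`. -/
noncomputable def interference (β : ℝ) (x : ℕ → Plane) (h : ℕ → ℝ) (u : Plane) (i : ℕ) : ℝ :=
  ∑' j : {j : ℕ // j ≠ i}, receivedPower β x h u j

/-- Signal-to-interference-plus-noise ratio at `u` when served by the base station `i`; the noise
power is `σ ^ 2`. -/
noncomputable def sinr (β σ : ℝ) (x : ℕ → Plane) (h : ℕ → ℝ) (u : Plane) (i : ℕ) : ℝ :=
  receivedPower β x h u i / (interference β x h u i + σ ^ 2)

/-- Instantaneous downlink data rate at `u` when served by the base station `i`. -/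
noncomputable def dataRate (β σ : ℝ) (x : ℕ → Plane) (h : ℕ → ℝ) (u : Plane) (i : ℕ) : ℝ :=
  Real.log (1 + sinr β σ x h u i)

/-- Instantaneous downlink data rate at `u` when served by the nearest base station. -/
noncomputable def nearestDataRate (β σ : ℝ) (x : ℕ → Plane) (h : ℕ → ℝ) (u : Plane) : ℝ :=
  dataRate β σ x h u (nearestIndex x u)

/-- The rate at `u` is well defined: there is a (strictly) nearest base station,
the interference series converges, and interference plus noise is positive. -/
def IsWellPosed (β σ : ℝ) (x : ℕ → Plane) (h : ℕ → ℝ) (u : Plane) : Prop :=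
  (∃ i, IsNearest x u i) ∧ Summable (fun j => receivedPower β x h u j) ∧
    0 < interference β x h u (nearestIndex x u) + σ ^ 2

/-- Location at slot `t` of the user that starts at the origin and travels, during the cycle
from slot `n * s` to slot `(n + 1) * s`, along the segment with increment `y n` at constant
velocity. -/
noncomputable def location (s : ℕ) (y : ℕ → Plane) (t : ℕ) : Plane :=
  ∑ k ∈ Finset.range (t / s), y k + (((t % s : ℕ) : ℝ) / (s : ℝ)) • y (t / s)

/-- `T` is the expected downlink data rate of a user whose instantaneous data rate at slot `t`
is `ξ t`: the long-run time average of the expected rates exists and equals `T`. -/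
def HasExpectedDataRate {Ω : Type*} [MeasurableSpace Ω] (P : Measure Ω) (ξ : ℕ → Ω → ℝ)
    (T : ℝ) : Prop :=
  (∀ t, Integrable (ξ t) P) ∧
    Tendsto (fun m : ℕ => (1 / (m : ℝ)) * ∫ ω, ∑ t ∈ Finset.range m, ξ t ω ∂P) atTop (𝓝 T)

/-- The function `ρ(z, w)`. -/
noncomputable def rho (lam β σ z w : ℝ) : ℝ :=
  Real.exp (-(σ ^ 2 * z * (w / (Real.pi * lam)) ^ (β / 2)) -
    w * (1 + 2 * z ^ (2 / β) / β * ∫ v in Ioi (1 / z), v ^ (2 / β - 1) / (1 + v)))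

/-- The double integral `∫₀^∞ ∫₀^∞ ρ(z, w) / (1 + z) dz dw`. -/
noncomputable def rateIntegral (lam β σ : ℝ) : ℝ :=
  ∫ w in Ioi (0 : ℝ), ∫ z in Ioi (0 : ℝ), rho lam β σ z w / (1 + z)

end CellularNetwork

/-! By stationarity, a location independent of the Poisson process sees the same configuration in
law as the origin. At each slot the moving user is at a measurable function of the displacements, so
its rate has the law of a static rate. The expected rate is thus the same at every slot, the time
averages are constant, and one static expectation has to be computed.

All information on the process is taken from its Laplace functional for test functions with values
in [0, ∞]; the value ∞ encodes void events. `IsPoissonPointProcess.hasPoissonLaplace_sub` shows that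
it survives an independent random translation. It also yields a unique nearest point and the
convergence of path-loss sums (`HasPoissonLaplace.ae_isRegular`).

For a fixed configuration with nearest distance r, the event SINR > z says that the serving fading
exceeds a threshold built from the other, independent fadings. The exponential tail and the
transform E exp(-aH) = 1/(1+a) turn its probability into a noise factor times the product of
1/(1+a_j), where a_j = z (r/|x_j|)^β (`measure_lt_sinr`). To average over the configuration one
needs that, given the nearest distance R, the farther points are still Poisson. This is proved
without conditional laws: R is rounded up to a grid, void probabilities factor the expectation on
each ring (`HasPoissonLaplace.setLIntegral_annulus`), and the mesh tends to zero. Since πλR² is a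
unit exponential variable, the mean coverage is ∫ ρ(z, w) dw.

Finally log(1+S) = ∫_0^S dz/(1+z), so the expected rate is the integral of P(SINR > z)/(1+z). It is
finite because ∫ ρ(z, w) dw decays at least as fast as a multiple of z^(-2/β). -/

namespace CellularNetwork

/-! ### The exponential exp(-x) on [0, ∞] -/

/-- The function `x ↦ exp (-x)` on `[0, ∞]`, with value `0` at `∞`. -/
noncomputable def expNeg (x : ℝ≥0∞) : ℝ≥0∞ := (EReal.exp (x : EReal))⁻¹

lemma continuous_expNeg : Continuous expNeg :=
  continuous_inv.comp (ENNReal.continuous_exp.comp continuous_coe_ennreal_ereal)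

lemma measurable_expNeg : Measurable expNeg := continuous_expNeg.measurable

@[fun_prop]
lemma Measurable.expNeg {α : Type*} [MeasurableSpace α] {f : α → ℝ≥0∞} (hf : Measurable f) :
    Measurable fun x => expNeg (f x) := measurable_expNeg.comp hf

@[simp] lemma expNeg_zero : expNeg 0 = 1 := by simp [expNeg]

@[simp] lemma expNeg_top : expNeg ∞ = 0 := by simp [expNeg]

lemma expNeg_ofReal {x : ℝ} (hx : 0 ≤ x) :
    expNeg (ENNReal.ofReal x) = ENNReal.ofReal (Real.exp (-x)) := by
  rw [expNeg, EReal.coe_ennreal_ofReal, max_eq_left hx, EReal.exp_coe,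
    ← ENNReal.ofReal_inv_of_pos (Real.exp_pos _), Real.exp_neg]

lemma expNeg_antitone : Antitone expNeg := fun _ _ h =>
  ENNReal.inv_le_inv.mpr (EReal.exp_monotone (EReal.coe_ennreal_le_coe_ennreal_iff.mpr h))

lemma expNeg_le_one (x : ℝ≥0∞) : expNeg x ≤ 1 := by
  simpa using expNeg_antitone (zero_le (a := x))

lemma expNeg_ne_top (x : ℝ≥0∞) : expNeg x ≠ ∞ :=
  ((expNeg_le_one x).trans_lt ENNReal.one_lt_top).ne

lemma expNeg_add (x y : ℝ≥0∞) : expNeg (x + y) = expNeg x * expNeg y := by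
  have h (z : ℝ≥0∞) : EReal.exp (z : EReal) ≠ 0 := by
    rw [Ne, EReal.exp_eq_zero_iff]; exact EReal.coe_ennreal_ne_bot z
  rw [expNeg, expNeg, expNeg, EReal.coe_ennreal_add, EReal.exp_add,
    ENNReal.mul_inv (Or.inl (h x)) (Or.inr (h y))]

lemma expNeg_sum {ι : Type*} (s : Finset ι) (f : ι → ℝ≥0∞) :
    expNeg (∑ i ∈ s, f i) = ∏ i ∈ s, expNeg (f i) := by
  classical
  induction s using Finset.induction_on with
  | empty => simp
  | insert a s ha ih => rw [Finset.sum_insert ha, Finset.prod_insert ha, expNeg_add, ih]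

lemma expNeg_mul_natCast (x : ℝ≥0∞) (n : ℕ) : expNeg (x * n) = expNeg x ^ n := by
  induction n with
  | zero => simp
  | succ n ih => rw [Nat.cast_succ, mul_add, mul_one, expNeg_add, ih, pow_succ]

lemma one_sub_expNeg_ofReal {x : ℝ} (hx : 0 ≤ x) :
    1 - expNeg (ENNReal.ofReal x) = ENNReal.ofReal (1 - Real.exp (-x)) := by
  rw [expNeg_ofReal hx, ENNReal.ofReal_sub _ (Real.exp_pos _).le, ENNReal.ofReal_one]

lemma one_sub_expNeg_le (x : ℝ≥0∞) : 1 - expNeg x ≤ x := by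
  induction x with
  | top => simp
  | coe x =>
    rw [← ENNReal.ofReal_coe_nnreal, one_sub_expNeg_ofReal x.coe_nonneg]
    exact ENNReal.ofReal_le_ofReal (by linarith [Real.add_one_le_exp (-(x : ℝ))])

lemma expNeg_log {x : ℝ} (hx : 1 ≤ x) :
    expNeg (ENNReal.ofReal (Real.log x)) = ENNReal.ofReal x⁻¹ := by
  rw [expNeg_ofReal (Real.log_nonneg hx), Real.exp_neg, Real.exp_log (by linarith)]

lemma one_sub_expNeg_indicator {α : Type*} (B : Set α) (c : ℝ≥0∞) (x : α) :
    1 - expNeg (B.indicator (fun _ => c) x) = B.indicator (fun _ => 1 - expNeg c) x := by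
  by_cases h : x ∈ B <;> simp [h]

/-- The exponential series, with q = exp(-c) as the variable. This also covers c = ∞: there q = 0,
and only k = 0 contributes. -/
lemma lintegral_expNeg_poissonMeasure (r : ℝ≥0) (c : ℝ≥0∞) :
    ∫⁻ k : ℕ, expNeg (c * k) ∂(poissonMeasure r) = expNeg (r * (1 - expNeg c)) := by
  obtain ⟨q, hq⟩ : ∃ q : ℝ≥0, expNeg c = q := ⟨_, (ENNReal.coe_toNNReal (expNeg_ne_top c)).symm⟩
  have hq1 : (q : ℝ) ≤ 1 := by
    have := expNeg_le_one c
    rw [hq] at this; exact_mod_cast this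
  rw [lintegral_countable', hq]
  have h1 : (r : ℝ≥0∞) * (1 - q) = ENNReal.ofReal (r * (1 - q)) := by
    rw [ENNReal.ofReal_mul r.coe_nonneg, ENNReal.ofReal_sub _ q.coe_nonneg]; simp
  rw [h1, expNeg_ofReal (mul_nonneg r.coe_nonneg (by linarith))]
  have hs : HasSum (fun n : ℕ => Real.exp (-r) * ((r * q : ℝ) ^ n / (n.factorial : ℝ)))
      (Real.exp (-r) * Real.exp (r * q)) := by
    apply HasSum.mul_left
    rw [Real.exp_eq_exp_ℝ]
    exact NormedSpace.expSeries_div_hasSum_exp (𝔸 := ℝ) (r * q : ℝ)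
  have : Real.exp (-(r * (1 - q))) = Real.exp (-r) * Real.exp (r * q) := by
    rw [← Real.exp_add]; congr 1; ring
  rw [this, ← hs.tsum_eq, ENNReal.ofReal_tsum_of_nonneg (fun n => by positivity) hs.summable]
  refine tsum_congr fun n => ?_
  rw [expNeg_mul_natCast, hq, poissonMeasure_singleton, ← ENNReal.ofReal_coe_nnreal (p := q),
    ← ENNReal.ofReal_pow q.coe_nonneg, ← ENNReal.ofReal_mul (by positivity)]
  congr 1
  rw [mul_pow]; ring

lemma expNeg_tsum {f : ℕ → ℝ≥0∞} :
    Tendsto (fun n => ∏ i ∈ Finset.range n, expNeg (f i)) atTop (𝓝 (expNeg (∑' i, f i))) := by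
  simp_rw [← expNeg_sum]
  exact (continuous_expNeg.tendsto _).comp (ENNReal.tendsto_nat_tsum f)

/-! ### Laplace functional of a Poisson point process -/

section Laplace

variable {Ω E : Type*} [MeasurableSpace Ω] [MeasurableSpace E] {Φ : Ω → Measure E}
  {Λ : Measure E} {P : Measure Ω}

lemma IsPoissonPointProcess.measurable_count (h : IsPoissonPointProcess Φ Λ P) {B : Set E}
    (hB : MeasurableSet B) : Measurable fun ω => Φ ω B :=
  (Measure.measurable_coe hB).comp h.measurable

lemma IsPoissonPointProcess.lintegral_expNeg_count (h : IsPoissonPointProcess Φ Λ P) {B : Set E}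
    (hB : MeasurableSet B) (hfin : Λ B < ∞) (c : ℝ≥0∞) :
    ∫⁻ ω, expNeg (c * Φ ω B) ∂P = expNeg (Λ B * (1 - expNeg c)) := by
  have hm : Measurable fun x : ℝ≥0∞ => expNeg (c * x) := by fun_prop
  rw [(h.hasLaw_count B hB hfin).lintegral_comp (X := fun ω => Φ ω B) hm.aemeasurable,
    lintegral_map hm (measurable_of_countable _), lintegral_expNeg_poissonMeasure,
    ENNReal.coe_toNNReal hfin.ne]

/-- The level sets of f are disjoint, so their counts are independent Poisson variables and the
expectation factors. Level 0 contributes nothing and is discarded, since it may have infinite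
intensity. -/
lemma IsPoissonPointProcess.lintegral_expNeg_simpleFunc (h : IsPoissonPointProcess Φ Λ P)
    (f : SimpleFunc E ℝ≥0∞) (hf : ∀ c, c ≠ 0 → Λ (f ⁻¹' {c}) < ∞) :
    ∫⁻ ω, expNeg (f.lintegral (Φ ω)) ∂P = expNeg (∫⁻ x, (1 - expNeg (f x)) ∂Λ) := by
  classical
  set s : Finset ℝ≥0∞ := {c ∈ f.range | c ≠ 0} with hs
  have key (g : ℝ≥0∞ → ℝ≥0∞) (hg : g 0 = 0) (μ : Measure E) :
      (f.map g).lintegral μ = ∑ c ∈ s, g c * μ (f ⁻¹' {c}) := by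
    rw [SimpleFunc.map_lintegral, hs, Finset.sum_filter]
    refine Finset.sum_congr rfl fun c _ => ?_
    by_cases hc : c = 0 <;> simp [hc, hg]
  have hid (μ : Measure E) : f.lintegral μ = ∑ c ∈ s, c * μ (f ⁻¹' {c}) := key id rfl μ
  have hr : ∫⁻ x, (1 - expNeg (f x)) ∂Λ = ∑ c ∈ s, (1 - expNeg c) * Λ (f ⁻¹' {c}) := by
    rw [← key (fun c => 1 - expNeg c) (by simp), ← SimpleFunc.lintegral_eq_lintegral]
    simp
  let e := s.equivFin
  have hprod (F : ℝ≥0∞ → ℝ≥0∞) : ∏ c ∈ s, F c = ∏ i : Fin s.card, F (e.symm i) := by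
    rw [← Finset.prod_coe_sort, ← e.symm.prod_comp]
  have hind := h.iIndepFun_count s.card (fun i => f ⁻¹' {(e.symm i : ℝ≥0∞)})
    (fun i => f.measurableSet_preimage _) (fun i j hij => by
      refine Disjoint.preimage _ ?_
      rw [Set.disjoint_singleton]
      exact fun h' => hij (e.symm.injective (Subtype.ext h')))
  have hind' := hind.comp (fun i x => expNeg ((e.symm i : ℝ≥0∞) * x))
    (fun i => by fun_prop)
  simp_rw [hid, hr, expNeg_sum, hprod]
  refine (lintegral_prod_eq_prod_lintegral_of_indepFun Finset.univ _ hind' fun i =>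
    (by fun_prop : Measurable fun x : ℝ≥0∞ => expNeg ((e.symm i : ℝ≥0∞) * x)).comp
      (h.measurable_count (f.measurableSet_preimage _))).trans ?_
  refine Finset.prod_congr rfl fun i _ => ?_
  have hne : (e.symm i : ℝ≥0∞) ≠ 0 := (Finset.mem_filter.mp (e.symm i).2).2
  rw [mul_comm]
  exact h.lintegral_expNeg_count (f.measurableSet_preimage _) (hf _ hne) _

/-- The Laplace functional of a Poisson point process. -/
theorem IsPoissonPointProcess.lintegral_expNeg [SigmaFinite Λ]
    (h : IsPoissonPointProcess Φ Λ P) [IsProbabilityMeasure P] {f : E → ℝ≥0∞}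
    (hf : Measurable f) :
    ∫⁻ ω, expNeg (∫⁻ x, f x ∂Φ ω) ∂P = expNeg (∫⁻ x, (1 - expNeg (f x)) ∂Λ) := by
  -- Cutting off outside a set of finite intensity gives every nonzero level finite intensity. The
  -- sequence still increases to f.
  let F (n : ℕ) : SimpleFunc E ℝ≥0∞ := (SimpleFunc.eapprox f n).restrict (spanningSets Λ n)
  have hFe (n : ℕ) (x : E) :
      F n x = (spanningSets Λ n).indicator (SimpleFunc.eapprox f n) x := by
    rw [SimpleFunc.restrict_apply _ (measurableSet_spanningSets Λ n)]
  have hmono (x : E) : Monotone fun n => F n x := fun m n hmn => by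
    simp only [hFe]
    refine (indicator_le_indicator_of_subset (monotone_spanningSets Λ hmn)
      (fun _ => zero_le) x).trans (indicator_le_indicator ?_)
    exact SimpleFunc.monotone_eapprox f hmn x
  have hlim (x : E) : Tendsto (fun n => F n x) atTop (𝓝 (f x)) := by
    have h1 : Tendsto (fun n => SimpleFunc.eapprox f n x) atTop (𝓝 (f x)) := by
      rw [← SimpleFunc.iSup_eapprox_apply hf x]
      exact tendsto_atTop_iSup fun m n hmn => SimpleFunc.monotone_eapprox f hmn x
    refine h1.congr' ?_
    obtain ⟨N, hN⟩ : ∃ N, x ∈ spanningSets Λ N := by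
      have := mem_univ x
      rw [← iUnion_spanningSets Λ] at this
      exact mem_iUnion.mp this
    filter_upwards [eventually_ge_atTop N] with n hn
    rw [hFe, indicator_of_mem (monotone_spanningSets Λ hn hN)]
  have hfin (n : ℕ) (c : ℝ≥0∞) (hc : c ≠ 0) : Λ (F n ⁻¹' {c}) < ∞ := by
    refine (measure_mono fun x hx => ?_).trans_lt (measure_spanningSets_lt_top Λ n)
    by_contra hx'
    rw [mem_preimage, mem_singleton_iff, hFe, indicator_of_notMem hx'] at hx
    exact hc hx.symm
  have hL : Tendsto (fun n => ∫⁻ ω, expNeg ((F n).lintegral (Φ ω)) ∂P) atTop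
      (𝓝 (∫⁻ ω, expNeg (∫⁻ x, f x ∂Φ ω) ∂P)) := by
    refine tendsto_lintegral_of_dominated_convergence (fun _ => 1) (fun n => ?_)
      (fun n => Eventually.of_forall fun ω => expNeg_le_one _) (by simp)
      (Eventually.of_forall fun ω => ?_)
    · refine Measurable.expNeg ?_
      simp_rw [← SimpleFunc.lintegral_eq_lintegral]
      exact (Measure.measurable_lintegral (F n).measurable).comp h.measurable
    · refine (continuous_expNeg.tendsto _).comp ?_
      simp_rw [← SimpleFunc.lintegral_eq_lintegral]
      exact lintegral_tendsto_of_tendsto_of_monotone (fun n => (F n).measurable.aemeasurable)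
        (Eventually.of_forall hmono) (Eventually.of_forall hlim)
  have hR : Tendsto (fun n => expNeg (∫⁻ x, (1 - expNeg (F n x)) ∂Λ)) atTop
      (𝓝 (expNeg (∫⁻ x, (1 - expNeg (f x)) ∂Λ))) := by
    refine (continuous_expNeg.tendsto _).comp ?_
    refine lintegral_tendsto_of_tendsto_of_monotone
      (fun n => (by fun_prop : Measurable fun x => 1 - expNeg (F n x)).aemeasurable)
      (Eventually.of_forall fun x m n hmn => tsub_le_tsub_left (expNeg_antitone (hmono x hmn)) _)
      (Eventually.of_forall fun x => ?_)
    exact ENNReal.Tendsto.sub tendsto_const_nhds ((continuous_expNeg.tendsto _).comp (hlim x))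
      (Or.inl ENNReal.one_ne_top)
  refine tendsto_nhds_unique hL (hR.congr fun n => ?_)
  exact (h.lintegral_expNeg_simpleFunc (F n) (hfin n)).symm

end Laplace

/-! ### Locally finite measures as an s-finite kernel -/

section Kernel

variable {E : Type*} [MeasurableSpace E]

/-- The kernel `φ ↦ φ.restrict A` on the set of measures `φ` with `k ≤ φ A < k + 1`. -/
noncomputable def restrictKernel (A : Set E) (hA : MeasurableSet A) (k : ℕ) :
    Kernel (Measure E) E :=
  open scoped Classical in
  Kernel.piecewise (s := {φ : Measure E | φ A ∈ Ico (k : ℝ≥0∞) (k + 1)})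
    (Measure.measurable_coe hA measurableSet_Ico)
    ⟨fun φ => φ.restrict A, Measure.measurable_of_measurable_coe _ fun B hB => by
      simp_rw [Measure.restrict_apply hB]
      exact Measure.measurable_coe (hB.inter hA)⟩ 0

/-- The slice φ A < k + 1 provides a mass bound uniform in φ. -/
instance (A : Set E) (hA : MeasurableSet A) (k : ℕ) : IsFiniteKernel (restrictKernel A hA k) := by
  classical
  refine ⟨⟨k + 1, by simp, fun φ => ?_⟩⟩
  rw [restrictKernel, Kernel.piecewise_apply]
  split_ifs with h
  · simpa using h.2.le
  · simp

/-- Only the slice k = ⌊φ A⌋ contributes. -/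
lemma sum_restrictKernel (A : Set E) (hA : MeasurableSet A) {φ : Measure E} (hφ : φ A < ∞) :
    Measure.sum (fun k => restrictKernel A hA k φ) = φ.restrict A := by
  classical
  ext B hB
  rw [Measure.sum_apply _ hB, tsum_eq_single ⌊(φ A).toReal⌋₊]
  · rw [restrictKernel, Kernel.piecewise_apply, if_pos]
    · rfl
    · have h1 := Nat.floor_le (ENNReal.toReal_nonneg (a := φ A))
      have h2 := Nat.lt_floor_add_one (φ A).toReal
      constructor
      · rwa [← ENNReal.ofReal_natCast, ENNReal.ofReal_le_iff_le_toReal hφ.ne]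
      · rw [← ENNReal.ofReal_natCast, ← ENNReal.ofReal_one,
          ← ENNReal.ofReal_add (Nat.cast_nonneg _) zero_le_one]
        exact (ENNReal.lt_ofReal_iff_toReal_lt hφ.ne).mpr h2
  · intro k hk
    rw [restrictKernel, Kernel.piecewise_apply, if_neg]
    · simp
    · rintro ⟨h1, h2⟩
      refine hk ((Nat.floor_eq_iff ENNReal.toReal_nonneg).mpr ⟨?_, ?_⟩).symm
      · simpa using ENNReal.toReal_mono hφ.ne h1
      · have h3 : (k + 1 : ℝ≥0∞) ≠ ∞ := by simp
        have := (ENNReal.toReal_lt_toReal hφ.ne h3).mpr h2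
        rwa [ENNReal.toReal_add (by simp) (by simp), ENNReal.toReal_natCast,
          ENNReal.toReal_one] at this

/-- An s-finite kernel that is the identity on the measures that are finite on the sets `A n`,
which form a partition. -/
lemma exists_isSFiniteKernel_eq (A : ℕ → Set E) (hA : ∀ n, MeasurableSet (A n))
    (hd : Pairwise (Function.onFun Disjoint A)) (hU : ⋃ n, A n = univ) :
    ∃ κ : Kernel (Measure E) E, IsSFiniteKernel κ ∧
      ∀ φ : Measure E, (∀ n, φ (A n) < ∞) → κ φ = φ := by
  refine ⟨Kernel.sum fun n => Kernel.sum fun k => restrictKernel (A n) (hA n) k,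
    inferInstance, fun φ hφ => ?_⟩
  rw [Kernel.sum_apply]
  simp_rw [Kernel.sum_apply]
  simp_rw [sum_restrictKernel _ _ (hφ _)]
  rw [← Measure.restrict_iUnion hd hA, hU, Measure.restrict_univ]

end Kernel

/-! ### Invariance under an independent translation -/

section Shift

variable {Ω : Type*} [MeasurableSpace Ω] {P : Measure Ω}

/-- The sequence of random points `X` has the Laplace functional of a Poisson point process with
intensity measure `Λ`. -/
def HasPoissonLaplace (X : ℕ → Ω → Plane) (Λ : Measure Plane) (P : Measure Ω) : Prop :=
  ∀ f : Plane → ℝ≥0∞, Measurable f →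
    ∫⁻ ω, expNeg (∑' i, f (X i ω)) ∂P = expNeg (∫⁻ x, (1 - expNeg (f x)) ∂Λ)

lemma lintegral_pointMeasure (x : ℕ → Plane) {f : Plane → ℝ≥0∞} (hf : Measurable f) :
    ∫⁻ y, f y ∂pointMeasure x = ∑' i, f (x i) := by
  rw [pointMeasure, lintegral_sum_measure]
  exact tsum_congr fun i => lintegral_dirac' _ hf

lemma IsPoissonPointProcess.ae_count_lt_top {E : Type*} [MeasurableSpace E] {Φ : Ω → Measure E}
    {Λ : Measure E} (h : IsPoissonPointProcess Φ Λ P) {B : Set E} (hB : MeasurableSet B)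
    (hfin : Λ B < ∞) : ∀ᵐ ω ∂P, Φ ω B < ∞ := by
  rw [(h.hasLaw_count B hB hfin).ae_iff (X := fun ω => Φ ω B) (p := fun x => x < ∞)
    measurableSet_Iio.mem,
    ae_map_iff (measurable_of_countable _).aemeasurable measurableSet_Iio]
  exact Eventually.of_forall fun k => by simp

/-- Integrate first over the process with the displacement frozen at u: the shifted test function
has the same Laplace functional by translation invariance of Lebesgue measure, so the result does
not depend on u. -/
lemma IsPoissonPointProcess.hasPoissonLaplace_sub [IsProbabilityMeasure P] {X : ℕ → Ω → Plane}
    {c : ℝ≥0∞} {U : Ω → Plane} [SigmaFinite (c • (volume : Measure Plane))]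
    (h : IsPoissonPointProcess (fun ω => pointMeasure fun i => X i ω) (c • volume) P)
    (hU : Measurable U) (hind : IndepFun (fun ω => pointMeasure fun i => X i ω) U P) :
    HasPoissonLaplace (fun i ω => X i ω - U ω) (c • volume) P := by
  intro f hf
  set Λ : Measure Plane := c • volume with hΛ
  set Φ : Ω → Measure Plane := fun ω => pointMeasure fun i => X i ω with hΦ
  -- Fubini needs ∫ f(x - u) dφ(x) to be jointly measurable in (φ, u). This holds for an s-finite
  -- kernel, so φ is replaced by κ φ, which agrees with it almost surely.
  obtain ⟨κ, hκ, hκe⟩ := exists_isSFiniteKernel_eq (disjointed (spanningSets Λ))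
    (fun n => MeasurableSet.disjointed (measurableSet_spanningSets Λ) n)
    (disjoint_disjointed _) (by rw [iUnion_disjointed, iUnion_spanningSets])
  have hae : ∀ᵐ ω ∂P, κ (Φ ω) = Φ ω := by
    have : ∀ᵐ ω ∂P, ∀ n, Φ ω (disjointed (spanningSets Λ) n) < ∞ :=
      ae_all_iff.mpr fun n => h.ae_count_lt_top
        (MeasurableSet.disjointed (measurableSet_spanningSets Λ) n)
        ((measure_mono (disjointed_le _ n)).trans_lt (measure_spanningSets_lt_top Λ n))
    filter_upwards [this] with ω hω using hκe _ hω
  let G : Measure Plane × Plane → ℝ≥0∞ := fun p => expNeg (∫⁻ x, f (x - p.2) ∂κ p.1)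
  have hG : Measurable G := by
    refine Measurable.expNeg ?_
    exact Measurable.lintegral_kernel_prod_right' (κ := κ.comap Prod.fst measurable_fst)
      (f := fun q : (Measure Plane × Plane) × Plane => f (q.2 - q.1.2)) (by fun_prop)
  have hshift (u : Plane) : Measurable fun x => f (x - u) := by fun_prop
  have h1 : ∀ᵐ ω ∂P, expNeg (∑' i, f (X i ω - U ω)) = G (Φ ω, U ω) := by
    filter_upwards [hae] with ω hω
    simp only [G]
    rw [hω, hΦ, lintegral_pointMeasure _ (hshift _)]
  have hmap := (indepFun_iff_map_prod_eq_prod_map_map h.measurable.aemeasurable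
    hU.aemeasurable).mp hind
  have hPU : IsProbabilityMeasure (P.map U) := Measure.isProbabilityMeasure_map hU.aemeasurable
  have hPΦ : IsProbabilityMeasure (P.map Φ) :=
    Measure.isProbabilityMeasure_map h.measurable.aemeasurable
  rw [lintegral_congr_ae h1, ← lintegral_map hG (h.measurable.prodMk hU), hmap,
    lintegral_prod_symm _ hG.aemeasurable]
  have h2 (u : Plane) : ∫⁻ φ, G (φ, u) ∂(P.map Φ) = expNeg (∫⁻ x, (1 - expNeg (f x)) ∂Λ) := by
    rw [lintegral_map (by fun_prop) h.measurable]
    have : ∀ᵐ ω ∂P, G (Φ ω, u) = expNeg (∫⁻ x, f (x - u) ∂Φ ω) := by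
      filter_upwards [hae] with ω hω
      simp only [G]
      rw [hω]
    rw [lintegral_congr_ae this, h.lintegral_expNeg (hshift u), hΛ, lintegral_smul_measure,
      lintegral_smul_measure, lintegral_sub_right_eq_self (fun x => 1 - expNeg (f x)) u]
  simp_rw [h2]
  simp

end Shift

/-! ### Regular configurations -/

/-- A configuration of base stations for which the rate at the origin is well defined for almost
all values of the fading variables. -/
structure IsRegular (β : ℝ) (x : ℕ → Plane) : Prop where
  norm_ne : ∀ i j, i ≠ j → ‖x i‖ ≠ ‖x j‖
  ne_zero : ∀ i, x i ≠ 0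
  summable : Summable fun j => (1 + ‖x j‖) ^ (-β)

namespace IsRegular

variable {β : ℝ} {x : ℕ → Plane}

lemma norm_pos (h : IsRegular β x) (i : ℕ) : 0 < ‖x i‖ := norm_pos_iff.mpr (h.ne_zero i)

/-- The terms of a convergent series tend to 0, which leaves only finitely many points in each disc.
-/
lemma tendsto_norm (h : IsRegular β x) (hβ : 2 < β) : Tendsto (fun j => ‖x j‖) cofinite atTop := by
  rw [tendsto_atTop]
  intro M
  have hpos : 0 < (1 + max M 0) ^ (-β) := Real.rpow_pos_of_pos (by positivity) _
  filter_upwards [h.summable.tendsto_cofinite_zero.eventually (gt_mem_nhds hpos)] with j hj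
  by_contra! hM
  refine absurd hj (not_lt.mpr ?_)
  exact Real.rpow_le_rpow_of_nonpos (by positivity)
    (by linarith [le_max_left M 0]) (by linarith)

/-- All but finitely many points have norm at least 1, where 1 + |x| ≤ 2|x|; this is the source of
the factor 2^β. -/
lemma summable_norm (h : IsRegular β x) (hβ : 2 < β) : Summable fun j => ‖x j‖ ^ (-β) := by
  refine (h.summable.mul_left (2 ^ β)).of_norm_bounded_eventually ?_
  filter_upwards [(h.tendsto_norm hβ).eventually_ge_atTop 1] with j hj
  rw [Real.norm_of_nonneg (by positivity), Real.rpow_neg (by positivity),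
    Real.rpow_neg (by positivity), ← div_eq_mul_inv, ← one_div,
    div_le_div_iff₀ (by positivity) (by positivity), one_mul,
    ← Real.mul_rpow (by norm_num) (by positivity)]
  exact Real.rpow_le_rpow (by positivity) (by linarith) (by linarith)

lemma exists_isNearest (h : IsRegular β x) (hβ : 2 < β) : ∃ i, IsNearest x 0 i := by
  have hfin : {j | ¬ ‖x 0‖ < ‖x j‖}.Finite :=
    (h.tendsto_norm hβ).eventually_gt_atTop ‖x 0‖
  obtain ⟨i, hi, hmin⟩ := hfin.toFinset.exists_min_image (fun j => ‖x j‖) ⟨0, by simp⟩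
  simp only [Finite.mem_toFinset, mem_ofPred_eq, not_lt] at hi hmin
  refine ⟨i, fun j hj => ?_⟩
  rw [sub_zero, sub_zero]
  rcases le_or_gt ‖x j‖ ‖x 0‖ with h' | h'
  · exact lt_of_le_of_ne (hmin j h') (h.norm_ne i j hj.symm)
  · exact hi.trans_lt h'

end IsRegular

lemma IsNearest.unique {x : ℕ → Plane} {u : Plane} {i j : ℕ} (hi : IsNearest x u i)
    (hj : IsNearest x u j) : i = j := by
  by_contra h
  exact lt_asymm (hi j (Ne.symm h)) (hj i h)

lemma IsNearest.nearestIndex_eq {x : ℕ → Plane} {u : Plane} {i : ℕ} (hi : IsNearest x u i) :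
    nearestIndex x u = i := by
  have : {i | IsNearest x u i} = {i} := by
    ext j; exact ⟨fun hj => IsNearest.unique hj hi, fun hj => hj ▸ hi⟩
  rw [nearestIndex, this, csInf_singleton]

/-! ### Almost sure regularity from the Laplace functional -/

section Laplace

variable {Ω : Type*} [MeasurableSpace Ω] {P : Measure Ω} [IsProbabilityMeasure P]
  {X : ℕ → Ω → Plane} {Λ : Measure Plane}

/-- The probability that the sum S is finite is at least E exp(-εS), and this is at least exp(-ε ∫ f
dΛ), which tends to 1 along ε = 1/(n+1). -/
lemma HasPoissonLaplace.ae_tsum_lt_top (h : HasPoissonLaplace X Λ P)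
    (hX : ∀ i, Measurable (X i)) {f : Plane → ℝ≥0∞} (hf : Measurable f)
    (hfin : ∫⁻ x, f x ∂Λ < ∞) : ∀ᵐ ω ∂P, ∑' i, f (X i ω) < ∞ := by
  have hm : MeasurableSet {ω | ∑' i, f (X i ω) < ∞} := by
    refine measurableSet_lt (Measurable.tsum fun i => hf.comp (hX i)) measurable_const
  have key (n : ℕ) : expNeg (((n : ℝ≥0∞) + 1)⁻¹ * ∫⁻ x, f x ∂Λ) ≤
      P {ω | ∑' i, f (X i ω) < ∞} := by
    have h0 : ((n : ℝ≥0∞) + 1)⁻¹ ≠ 0 := by simp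
    calc expNeg (((n : ℝ≥0∞) + 1)⁻¹ * ∫⁻ x, f x ∂Λ)
        ≤ expNeg (∫⁻ x, (1 - expNeg (((n : ℝ≥0∞) + 1)⁻¹ * f x)) ∂Λ) := by
          refine expNeg_antitone ?_
          rw [← lintegral_const_mul _ hf]
          exact lintegral_mono fun x => one_sub_expNeg_le _
      _ = ∫⁻ ω, expNeg (∑' i, ((n : ℝ≥0∞) + 1)⁻¹ * f (X i ω)) ∂P :=
          (h _ (hf.const_mul _)).symm
      _ ≤ ∫⁻ ω, {ω | ∑' i, f (X i ω) < ∞}.indicator 1 ω ∂P := by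
          refine lintegral_mono fun ω => ?_
          by_cases hω : ∑' i, f (X i ω) < ∞
          · rw [indicator_of_mem (by exact hω)]; exact expNeg_le_one _
          · rw [not_lt, top_le_iff] at hω
            rw [ENNReal.tsum_mul_left, hω, ENNReal.mul_top h0, expNeg_top]
            exact zero_le
      _ = P {ω | ∑' i, f (X i ω) < ∞} := lintegral_indicator_one hm
  have hlim : Tendsto (fun n : ℕ => expNeg (((n : ℝ≥0∞) + 1)⁻¹ * ∫⁻ x, f x ∂Λ)) atTop
      (𝓝 1) := by
    have h1 : Tendsto (fun n : ℕ => ((n : ℝ≥0∞) + 1)⁻¹) atTop (𝓝 0) := by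
      have := (tendsto_add_atTop_iff_nat 1).mpr ENNReal.tendsto_inv_nat_nhds_zero
      simpa using this
    have h2 := ENNReal.Tendsto.mul_const (b := ∫⁻ x, f x ∂Λ) h1 (Or.inr hfin.ne)
    rw [zero_mul] at h2
    have h3 := (continuous_expNeg.tendsto 0).comp h2
    rwa [expNeg_zero] at h3
  exact (mem_ae_iff_prob_eq_one hm).mpr
    (le_antisymm prob_le_one (le_of_tendsto' hlim key))

/-- The function equal to ∞ on B has integral 0, so its sum over the points is finite, which forbids
any point in B. -/
lemma HasPoissonLaplace.ae_notMem (h : HasPoissonLaplace X Λ P)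
    (hX : ∀ i, Measurable (X i)) {B : Set Plane} (hB : MeasurableSet B) (h0 : Λ B = 0) :
    ∀ᵐ ω ∂P, ∀ i, X i ω ∉ B := by
  filter_upwards [h.ae_tsum_lt_top hX (f := B.indicator fun _ => ∞)
    (measurable_const.indicator hB) (by simp [lintegral_indicator hB, h0])] with ω hω i hi
  refine hω.ne (top_le_iff.mp (le_trans ?_ (ENNReal.le_tsum i)))
  simp [hi]

/-- With N points in B this reads 1{N ≥ 2} + 4·2^(-N) ≤ 2 + 2·0^N, with equality for N = 0 and N =
1. It bounds the event by Laplace functionals at the two weights log 2 and ∞. -/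
lemma indicator_two_points_le (B : Set Plane) (x : ℕ → Plane) :
    {x : ℕ → Plane | ∃ i j, i ≠ j ∧ x i ∈ B ∧ x j ∈ B}.indicator (1 : (ℕ → Plane) → ℝ≥0∞) x +
      4 * expNeg (∑' i, B.indicator (fun _ => ENNReal.ofReal (Real.log 2)) (x i)) ≤
      2 + 2 * expNeg (∑' i, B.indicator (fun _ => ∞) (x i)) := by
  have hlog : expNeg (ENNReal.ofReal (Real.log 2)) = 2⁻¹ := by
    rw [expNeg_log one_le_two, ENNReal.ofReal_inv_of_pos two_pos]; simp
  by_cases h2 : ∃ i j, i ≠ j ∧ x i ∈ B ∧ x j ∈ B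
  · rw [indicator_of_mem (by exact h2)]
    obtain ⟨i, j, hij, hi, hj⟩ := h2
    have h1 : expNeg (∑' i, B.indicator (fun _ => ENNReal.ofReal (Real.log 2)) (x i)) ≤ 4⁻¹ := by
      calc _ ≤ expNeg (∑ k ∈ {i, j}, B.indicator (fun _ => ENNReal.ofReal (Real.log 2)) (x k)) :=
            expNeg_antitone (ENNReal.sum_le_tsum _)
        _ = 4⁻¹ := by
            rw [Finset.sum_pair hij, indicator_of_mem hi, indicator_of_mem hj, expNeg_add, hlog,
              ← ENNReal.mul_inv (by simp) (by simp)]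
            norm_num
    calc _ ≤ (1 : ℝ≥0∞) + 4 * 4⁻¹ := by gcongr; simp
      _ = 2 := by rw [ENNReal.mul_inv_cancel (by simp) (by simp)]; norm_num
      _ ≤ _ := le_self_add
  · rw [indicator_of_notMem (by exact h2), zero_add]
    push Not at h2
    by_cases h1 : ∃ i, x i ∈ B
    · obtain ⟨i, hi⟩ := h1
      rw [tsum_eq_single i fun j hj => indicator_of_notMem (h2 i j hj.symm hi) _,
        indicator_of_mem hi, hlog]
      refine le_trans (le_of_eq ?_) le_self_add
      rw [show (4 : ℝ≥0∞) = 2 * 2 by norm_num, mul_assoc,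
        ENNReal.mul_inv_cancel (by simp) (by simp), mul_one]
    · push Not at h1
      simp only [indicator_of_notMem (h1 _), tsum_zero, expNeg_zero]
      norm_num

lemma HasPoissonLaplace.measure_two_points_le (h : HasPoissonLaplace X Λ P)
    (hX : ∀ i, Measurable (X i)) {B : Set Plane} (hB : MeasurableSet B) {l : ℝ} (hl : 0 ≤ l)
    (hΛ : Λ B = ENNReal.ofReal l) :
    P {ω | ∃ i j, i ≠ j ∧ X i ω ∈ B ∧ X j ω ∈ B} ≤ ENNReal.ofReal (l ^ 2) := by
  have hm : MeasurableSet {ω | ∃ i j, i ≠ j ∧ X i ω ∈ B ∧ X j ω ∈ B} := by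
    have : {ω | ∃ i j, i ≠ j ∧ X i ω ∈ B ∧ X j ω ∈ B} =
        ⋃ i, ⋃ j, ⋃ (_ : i ≠ j), X i ⁻¹' B ∩ X j ⁻¹' B := by
      ext ω
      simp only [mem_ofPred_eq, mem_iUnion, mem_inter_iff, mem_preimage, exists_prop]
    rw [this]
    exact MeasurableSet.iUnion fun i => MeasurableSet.iUnion fun j => MeasurableSet.iUnion fun _ =>
      (hX i hB).inter (hX j hB)
  have hc (c : ℝ≥0∞) : ∫⁻ ω, expNeg (∑' i, B.indicator (fun _ => c) (X i ω)) ∂P =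
      expNeg ((1 - expNeg c) * ENNReal.ofReal l) := by
    rw [h _ (measurable_const.indicator hB)]
    simp_rw [one_sub_expNeg_indicator]
    rw [lintegral_indicator_const hB, hΛ]
  have hmc (c : ℝ≥0∞) : Measurable fun ω =>
      expNeg (∑' i, B.indicator (fun _ => c) (X i ω)) :=
    Measurable.expNeg (Measurable.tsum fun i => (measurable_const.indicator hB).comp (hX i))
  have key : P {ω | ∃ i j, i ≠ j ∧ X i ω ∈ B ∧ X j ω ∈ B} +
      4 * expNeg (ENNReal.ofReal (l / 2)) ≤ 2 + 2 * expNeg (ENNReal.ofReal l) := by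
    have h1 := lintegral_mono (μ := P) fun ω => indicator_two_points_le B (fun i => X i ω)
    rw [lintegral_add_right _ ((hmc _).const_mul _), lintegral_const_mul _ (hmc _),
      lintegral_add_left measurable_const, lintegral_const_mul _ (hmc _), hc, hc,
      lintegral_const, measure_univ, mul_one, expNeg_top, tsub_zero, one_mul,
      expNeg_log one_le_two] at h1
    have h2 : (1 - ENNReal.ofReal 2⁻¹) * ENNReal.ofReal l = ENNReal.ofReal (l / 2) := by
      rw [← ENNReal.ofReal_one, ← ENNReal.ofReal_sub _ (by norm_num),
        ← ENNReal.ofReal_mul (by norm_num)]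
      congr 1; ring
    rw [h2] at h1
    refine le_trans (le_of_eq ?_) h1
    rw [← lintegral_indicator_one hm]
    rfl
  rw [expNeg_ofReal hl, expNeg_ofReal (by positivity)] at key
  have h4 : (4 : ℝ≥0∞) = ENNReal.ofReal 4 := by simp
  have h2 : (2 : ℝ≥0∞) = ENNReal.ofReal 2 := by simp
  rw [h4, h2, ← ENNReal.ofReal_mul (by norm_num), ← ENNReal.ofReal_mul (by norm_num),
    ← ENNReal.ofReal_add (by norm_num) (by positivity)] at key
  have key2 := ENNReal.le_sub_of_add_le_right ENNReal.ofReal_ne_top key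
  rw [← ENNReal.ofReal_sub _ (by positivity)] at key2
  refine key2.trans (ENNReal.ofReal_le_ofReal ?_)
  -- The bound obtained is 2 + 2e^(-l) - 4e^(-l/2) = 2(1 - e^(-l/2))², at most l²/2.
  have e1 : Real.exp (-l) = Real.exp (-(l / 2)) ^ 2 := by
    rw [← Real.exp_nat_mul]; congr 1; push_cast; ring
  have e2 := Real.add_one_le_exp (-(l / 2))
  have e3 : Real.exp (-(l / 2)) ≤ 1 := Real.exp_le_one_iff.mpr (by linarith)
  rw [e1]
  nlinarith

lemma volume_norm_sq_Ico {a b : ℝ} (ha : 0 ≤ a) (hab : a ≤ b) :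
    (volume : Measure Plane) {y | a ≤ ‖y‖ ^ 2 ∧ ‖y‖ ^ 2 < b} =
      ENNReal.ofReal (Real.pi * (b - a)) := by
  have hb (c : ℝ) (hc : 0 ≤ c) : {y : Plane | ‖y‖ ^ 2 < c} = Metric.ball 0 (Real.sqrt c) := by
    ext y
    simp [Real.lt_sqrt (norm_nonneg y)]
  have hv (c : ℝ) (hc : 0 ≤ c) :
      (volume : Measure Plane) {y : Plane | ‖y‖ ^ 2 < c} = ENNReal.ofReal (Real.pi * c) := by
    rw [hb c hc, EuclideanSpace.volume_ball_fin_two, ← ENNReal.ofReal_pow (Real.sqrt_nonneg _),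
      Real.sq_sqrt hc, ← NNReal.coe_real_pi, ENNReal.ofReal_mul (by positivity),
      ENNReal.ofReal_coe_nnreal, mul_comm]
  have : {y : Plane | a ≤ ‖y‖ ^ 2 ∧ ‖y‖ ^ 2 < b} =
      {y | ‖y‖ ^ 2 < b} \ {y | ‖y‖ ^ 2 < a} := by
    ext y; simp [and_comm]
  have hsub : {y : Plane | ‖y‖ ^ 2 < a} ⊆ {y | ‖y‖ ^ 2 < b} := fun y hy =>
    lt_of_lt_of_le (by exact hy) hab
  have hm : MeasurableSet {y : Plane | ‖y‖ ^ 2 < a} :=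
    measurableSet_lt (by fun_prop) measurable_const
  rw [this, measure_sdiff hsub hm.nullMeasurableSet (by rw [hv a ha]; simp),
    hv a ha, hv b (ha.trans hab), ← ENNReal.ofReal_sub _ (by positivity)]
  congr 1; ring

/-- Rings of width 1/(n+1) in the squared norm have equal area. Two points at equal distance share a
ring; the M(n+1) rings covering squared norms below M each contain two points with probability
O(1/n²), in total O(1/n). -/
lemma HasPoissonLaplace.ae_norm_ne {lam : ℝ} (hlam : 0 < lam)
    (h : HasPoissonLaplace X (ENNReal.ofReal lam • volume) P) (hX : ∀ i, Measurable (X i)) :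
    ∀ᵐ ω ∂P, ∀ i j, i ≠ j → ‖X i ω‖ ≠ ‖X j ω‖ := by
  have key (M : ℕ) : P {ω | ∃ i j, i ≠ j ∧ ‖X i ω‖ = ‖X j ω‖ ∧ ‖X i ω‖ ^ 2 < M} = 0 := by
    have hle (n : ℕ) : P {ω | ∃ i j, i ≠ j ∧ ‖X i ω‖ = ‖X j ω‖ ∧ ‖X i ω‖ ^ 2 < M} ≤
        ENNReal.ofReal ((M * (lam * Real.pi) ^ 2) * (1 / ((n : ℝ) + 1))) := by
      have hn : (0 : ℝ) < n + 1 := by positivity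
      let A (k : ℕ) : Set Plane :=
        {y | (k : ℝ) / (n + 1) ≤ ‖y‖ ^ 2 ∧ ‖y‖ ^ 2 < ((k : ℝ) + 1) / (n + 1)}
      have hA (k : ℕ) : MeasurableSet (A k) :=
        ((isClosed_le continuous_const (by fun_prop)).measurableSet.inter
          (isOpen_lt (by fun_prop) continuous_const).measurableSet :
          MeasurableSet ({y : Plane | (k : ℝ) / (n + 1) ≤ ‖y‖ ^ 2} ∩
            {y : Plane | ‖y‖ ^ 2 < ((k : ℝ) + 1) / (n + 1)}))
      have hΛ (k : ℕ) : (ENNReal.ofReal lam • volume : Measure Plane) (A k) =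
          ENNReal.ofReal (lam * Real.pi / (n + 1)) := by
        rw [Measure.smul_apply, volume_norm_sq_Ico (by positivity) (by gcongr; linarith),
          smul_eq_mul, ← ENNReal.ofReal_mul hlam.le]
        congr 1; field_simp; ring
      calc P {ω | ∃ i j, i ≠ j ∧ ‖X i ω‖ = ‖X j ω‖ ∧ ‖X i ω‖ ^ 2 < M}
          ≤ P (⋃ k ∈ Finset.range (M * (n + 1)),
              {ω | ∃ i j, i ≠ j ∧ X i ω ∈ A k ∧ X j ω ∈ A k}) := by
            refine measure_mono ?_
            rintro ω ⟨i, j, hij, he, hlt⟩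
            have h0 : 0 ≤ ‖X i ω‖ ^ 2 * (n + 1) := by positivity
            have hf1 := Nat.floor_le h0
            have hf2 := Nat.lt_floor_add_one (‖X i ω‖ ^ 2 * ((n : ℝ) + 1))
            have hmem : X i ω ∈ A ⌊‖X i ω‖ ^ 2 * ((n : ℝ) + 1)⌋₊ :=
              ⟨(div_le_iff₀ hn).mpr hf1, (lt_div_iff₀ hn).mpr hf2⟩
            simp only [mem_iUnion, mem_ofPred_eq]
            refine ⟨⌊‖X i ω‖ ^ 2 * ((n : ℝ) + 1)⌋₊, ?_, i, j, hij, hmem, ?_⟩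
            · rw [Finset.mem_range, Nat.floor_lt h0]
              push_cast
              gcongr
            · have := hmem
              simp only [A, mem_ofPred_eq] at this ⊢
              rwa [← he]
        _ ≤ ∑ k ∈ Finset.range (M * (n + 1)), ENNReal.ofReal ((lam * Real.pi / (n + 1)) ^ 2) :=
            (measure_biUnion_finset_le _ _).trans (Finset.sum_le_sum fun k _ =>
              h.measure_two_points_le hX (hA k) (by positivity) (hΛ k))
        _ = _ := by
            rw [Finset.sum_const, Finset.card_range, nsmul_eq_mul, ← ENNReal.ofReal_natCast,
              ← ENNReal.ofReal_mul (by positivity)]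
            congr 1; push_cast; field_simp
    have hlim : Tendsto (fun n : ℕ =>
        ENNReal.ofReal ((M * (lam * Real.pi) ^ 2) * (1 / ((n : ℝ) + 1)))) atTop (𝓝 0) := by
      have := ENNReal.tendsto_ofReal
        ((tendsto_one_div_add_atTop_nhds_zero_nat (𝕜 := ℝ)).const_mul (M * (lam * Real.pi) ^ 2))
      simpa using this
    exact le_antisymm (ge_of_tendsto' hlim hle) zero_le
  have : ∀ᵐ ω ∂P, ∀ M : ℕ, ¬ ∃ i j, i ≠ j ∧ ‖X i ω‖ = ‖X j ω‖ ∧ ‖X i ω‖ ^ 2 < M := by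
    rw [ae_all_iff]
    intro M
    rw [ae_iff]
    simpa using key M
  filter_upwards [this] with ω hω i j hij he
  obtain ⟨M, hM⟩ := exists_nat_gt (‖X i ω‖ ^ 2)
  exact hω M ⟨i, j, hij, he, hM⟩

lemma HasPoissonLaplace.ae_isRegular {lam β : ℝ} (hlam : 0 < lam) (hβ : 2 < β)
    (h : HasPoissonLaplace X (ENNReal.ofReal lam • volume) P) (hX : ∀ i, Measurable (X i)) :
    ∀ᵐ ω ∂P, IsRegular β fun i => X i ω := by
  have h0 := h.ae_notMem hX (B := {0}) (measurableSet_singleton _) (by simp)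
  -- The 1 in 1 + |y| removes the singularity at the origin; integrability at infinity in the plane
  -- is where β > 2 enters.
  have hs := h.ae_tsum_lt_top hX (f := fun y => ENNReal.ofReal ((1 + ‖y‖) ^ (-β))) (by fun_prop)
    (by
      rw [lintegral_smul_measure]
      exact ENNReal.mul_lt_top ENNReal.ofReal_lt_top
        (finite_integral_one_add_norm (by simpa using hβ)))
  filter_upwards [h.ae_norm_ne hlam hX, h0, hs] with ω h1 h2 h3
  refine ⟨h1, fun i => by simpa using h2 i, ?_⟩
  have := ENNReal.summable_toReal h3.ne
  refine this.congr fun i => ENNReal.toReal_ofReal (by positivity)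

end Laplace

/-! ### Exponential variables: tails and Laplace transforms -/

section Exponential

lemma measurable_exponentialPDF (r : ℝ) : Measurable (exponentialPDF r) :=
  (measurable_exponentialPDFReal r).ennreal_ofReal

lemma lintegral_expMeasure {r : ℝ} {f : ℝ → ℝ≥0∞} (hf : Measurable f) :
    ∫⁻ y, f y ∂expMeasure r = ∫⁻ y, exponentialPDF r y * f y := by
  change ∫⁻ y, f y ∂(volume.withDensity (exponentialPDF r)) = _
  rw [lintegral_withDensity_eq_lintegral_mul _ (measurable_exponentialPDF r) hf]
  rfl

/-- The tilted density is 1/(1+a) times the density of rate 1 + a. The value is written as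
exp(-log(1+a)) so that products over base stations become sums in the exponent. -/
lemma lintegral_expNeg_mul_expMeasure {a : ℝ} (ha : 0 ≤ a) :
    ∫⁻ y, expNeg (ENNReal.ofReal (a * y)) ∂expMeasure 1 =
      expNeg (ENNReal.ofReal (Real.log (1 + a))) := by
  rw [expNeg_log (by linarith), lintegral_expMeasure (by fun_prop)]
  have h (y : ℝ) : exponentialPDF 1 y * expNeg (ENNReal.ofReal (a * y)) =
      ENNReal.ofReal (1 + a)⁻¹ * exponentialPDF (1 + a) y := by
    rcases lt_or_ge y 0 with hy | hy
    · simp [exponentialPDF_of_neg hy]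
    · rw [exponentialPDF_of_nonneg hy, exponentialPDF_of_nonneg hy, expNeg_ofReal (by positivity),
        ← ENNReal.ofReal_mul (by positivity), ← ENNReal.ofReal_mul (by positivity), one_mul,
        ← Real.exp_add, ← mul_assoc, inv_mul_cancel₀ (by positivity), one_mul]
      congr 2; ring_nf
  simp_rw [h]
  rw [lintegral_const_mul _ (measurable_exponentialPDF _),
    lintegral_exponentialPDF_eq_one (by positivity), mul_one]

lemma lintegral_ofReal_expMeasure_lt_top : ∫⁻ y, ENNReal.ofReal y ∂expMeasure 1 < ∞ := by
  rw [lintegral_expMeasure (by fun_prop)]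
  -- From y ≤ 2 exp(y/2): the constant 4 is this 2 divided by the rate 1/2.
  have h (y : ℝ) : exponentialPDF 1 y * ENNReal.ofReal y ≤ 4 * exponentialPDF (1 / 2) y := by
    rcases lt_or_ge y 0 with hy | hy
    · simp [exponentialPDF_of_neg hy]
    · rw [exponentialPDF_of_nonneg hy, exponentialPDF_of_nonneg hy,
        show (4 : ℝ≥0∞) = ENNReal.ofReal 4 by simp,
        ← ENNReal.ofReal_mul (by positivity), ← ENNReal.ofReal_mul (by positivity)]
      refine ENNReal.ofReal_le_ofReal ?_
      have h1 := Real.add_one_le_exp (1 / 2 * y)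
      have h2 : Real.exp (-(1 / 2 * y)) = Real.exp (-(1 * y)) * Real.exp (1 / 2 * y) := by
        rw [← Real.exp_add]; congr 1; ring
      rw [h2]
      nlinarith [Real.exp_pos (-(1 * y))]
  refine (lintegral_mono h).trans_lt ?_
  rw [lintegral_const_mul _ (measurable_exponentialPDF _),
    lintegral_exponentialPDF_eq_one (by positivity)]
  simp

lemma expMeasure_Ioi {c : ℝ} (hc : 0 ≤ c) :
    expMeasure 1 (Ioi c) = ENNReal.ofReal (Real.exp (-c)) := by
  have : IsProbabilityMeasure (expMeasure 1) := isProbabilityMeasure_expMeasure one_pos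
  have h1 := cdf_expMeasure_eq one_pos c
  rw [cdf_eq_real, if_pos hc] at h1
  rw [← compl_Iic, prob_compl_eq_one_sub measurableSet_Iic, ← ofReal_measureReal, h1,
    ← ENNReal.ofReal_one, ← ENNReal.ofReal_sub _ (by simpa using hc)]
  congr 1; rw [one_mul]; ring

lemma expMeasure_lt_ofReal (t : ℝ≥0∞) : expMeasure 1 {y | t < ENNReal.ofReal y} = expNeg t := by
  induction t with
  | top => simp
  | coe t =>
    have : {y : ℝ | (t : ℝ≥0∞) < ENNReal.ofReal y} = Ioi (t : ℝ) := by
      ext y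
      rw [mem_ofPred_eq, mem_Ioi, ← ENNReal.ofReal_coe_nnreal, ENNReal.ofReal_lt_ofReal_iff']
      exact ⟨fun h => h.1, fun h => ⟨h, t.coe_nonneg.trans_lt h⟩⟩
    rw [this, expMeasure_Ioi t.coe_nonneg, ← expNeg_ofReal t.coe_nonneg,
      ENNReal.ofReal_coe_nnreal]

variable {Ω : Type*} [MeasurableSpace Ω] {P : Measure Ω}

lemma ae_pos_of_hasLaw_expMeasure {h : Ω → ℝ} (hh : HasLaw h (expMeasure 1) P) :
    ∀ᵐ ω ∂P, 0 < h ω := by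
  rw [hh.ae_iff (p := fun y => 0 < y) measurableSet_Ioi.mem]
  have : IsProbabilityMeasure (expMeasure 1) := isProbabilityMeasure_expMeasure one_pos
  refine (mem_ae_iff_prob_eq_one measurableSet_Ioi).mpr ?_
  rw [expMeasure_Ioi le_rfl]; simp

/-- Freeze T and use the tail exp(-t) of the exponential law; T = ∞ is allowed and contributes 0. -/
lemma measure_lt_of_indepFun [IsProbabilityMeasure P] {h : Ω → ℝ} {T : Ω → ℝ≥0∞}
    (hm : Measurable h) (hh : HasLaw h (expMeasure 1) P) (hT : Measurable T)
    (hind : IndepFun T h P) : P {ω | T ω < ENNReal.ofReal (h ω)} = ∫⁻ ω, expNeg (T ω) ∂P := by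
  have : IsProbabilityMeasure (expMeasure 1) := isProbabilityMeasure_expMeasure one_pos
  have hprod := (indepFun_iff_map_prod_eq_prod_map_map hT.aemeasurable hm.aemeasurable).mp hind
  have hS : MeasurableSet {p : ℝ≥0∞ × ℝ | p.1 < ENNReal.ofReal p.2} :=
    measurableSet_lt measurable_fst (by fun_prop)
  have h1 : {ω | T ω < ENNReal.ofReal (h ω)} =
      (fun ω => (T ω, h ω)) ⁻¹' {p : ℝ≥0∞ × ℝ | p.1 < ENNReal.ofReal p.2} := rfl
  rw [h1, ← Measure.map_apply (hT.prodMk hm) hS, hprod, hh.map_eq, Measure.prod_apply hS,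
    lintegral_map (measurable_measure_prodMk_left hS) hT]
  exact lintegral_congr fun ω => expMeasure_lt_ofReal _

/-- Independence gives the finite products; dominated convergence passes to the limit without
assuming that the a_j are summable. -/
lemma lintegral_expNeg_tsum_mul [IsProbabilityMeasure P] {h : ℕ → Ω → ℝ}
    (hm : ∀ i, Measurable (h i)) (hh : ∀ i, HasLaw (h i) (expMeasure 1) P) (hind : iIndepFun h P)
    {a : ℕ → ℝ} (ha : ∀ j, 0 ≤ a j) :
    ∫⁻ ω, expNeg (∑' j, ENNReal.ofReal (a j * h j ω)) ∂P =
      expNeg (∑' j, ENNReal.ofReal (Real.log (1 + a j))) := by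
  have hmeas (j : ℕ) : Measurable fun y : ℝ => expNeg (ENNReal.ofReal (a j * y)) := by fun_prop
  have h1 : Tendsto (fun n => ∫⁻ ω, ∏ j ∈ Finset.range n,
      expNeg (ENNReal.ofReal (a j * h j ω)) ∂P) atTop
      (𝓝 (∫⁻ ω, expNeg (∑' j, ENNReal.ofReal (a j * h j ω)) ∂P)) := by
    refine tendsto_lintegral_of_dominated_convergence (fun _ => 1)
      (fun n => Finset.measurable_fun_prod _ fun j _ => (hmeas j).comp (hm j))
      (fun n => Eventually.of_forall fun ω => Finset.prod_le_one' fun j _ => expNeg_le_one _)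
      (by simp) (Eventually.of_forall fun ω => expNeg_tsum)
  refine tendsto_nhds_unique h1 (expNeg_tsum.congr fun n => ?_)
  refine Eq.trans ?_ (lintegral_prod_eq_prod_lintegral_of_indepFun _ _ (hind.comp _ hmeas)
    fun j => (hmeas j).comp (hm j)).symm
  refine Finset.prod_congr rfl fun j _ => ?_
  rw [← lintegral_expNeg_mul_expMeasure (ha j), ← (hh j).lintegral_comp (hmeas j).aemeasurable]
  rfl

end Exponential

/-! ### Coverage probability for a fixed configuration -/

section Fading

variable {β σ : ℝ} {x : ℕ → Plane} {h : ℕ → ℝ}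

lemma receivedPower_zero (β : ℝ) (x : ℕ → Plane) (h : ℕ → ℝ) (j : ℕ) :
    receivedPower β x h 0 j = h j * ‖x j‖ ^ (-β) := by
  rw [receivedPower, sub_zero]

lemma interference_pos (hx : IsRegular β x) (hh : ∀ j, 0 < h j)
    (hs : Summable fun j => h j * ‖x j‖ ^ (-β)) (i : ℕ) : 0 < interference β x h 0 i := by
  have hpos (j : ℕ) : 0 < receivedPower β x h 0 j := by
    rw [receivedPower_zero]
    exact mul_pos (hh j) (Real.rpow_pos_of_pos (hx.norm_pos j) _)
  have hs' : Summable fun j => receivedPower β x h 0 j := by simpa only [receivedPower_zero]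
  exact (hs'.subtype _).tsum_pos (fun j => (hpos j).le) ⟨i + 1, by simp⟩ (hpos _)

lemma IsRegular.isWellPosed (hx : IsRegular β x) (hβ : 2 < β) (hh : ∀ j, 0 < h j)
    (hs : Summable fun j => h j * ‖x j‖ ^ (-β)) : IsWellPosed β σ x h 0 := by
  refine ⟨hx.exists_isNearest hβ, by simpa only [receivedPower_zero], ?_⟩
  have := interference_pos hx hh hs (nearestIndex x 0)
  positivity

/-- The relative strength of the interference from a base station at `y`, when the nearest base
station has distance `r`. -/
noncomputable def relativeGain (β z r : ℝ) (y : Plane) : ℝ :=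
  if r < ‖y‖ then z * r ^ β * ‖y‖ ^ (-β) else 0

lemma relativeGain_nonneg {z r : ℝ} (hz : 0 ≤ z) (hr : 0 ≤ r) (y : Plane) :
    0 ≤ relativeGain β z r y := by
  rw [relativeGain]; split_ifs <;> positivity

/-- Multiplying by the denominator and by |x_b|^β isolates the serving fading. The strict inequality
in `relativeGain` removes the serving station itself from the sum, since its norm equals r. -/
lemma lt_sinr_iff (hx : IsRegular β x) (hh : ∀ j, 0 < h j)
    (hs : Summable fun j => h j * ‖x j‖ ^ (-β)) {b : ℕ} (hb : IsNearest x 0 b) {z : ℝ}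
    (hz : 0 < z) :
    z < sinr β σ x h 0 b ↔ ENNReal.ofReal (z * σ ^ 2 * ‖x b‖ ^ β) +
      ∑' j, ENNReal.ofReal (relativeGain β z ‖x b‖ (x j) * h j) < ENNReal.ofReal (h b) := by
  have hr := hx.norm_pos b
  have hI := interference_pos hx hh hs b
  have hterm (j : ℕ) : relativeGain β z ‖x b‖ (x j) * h j =
      z * ‖x b‖ ^ β * ({j | j ≠ b} : Set ℕ).indicator (receivedPower β x h 0) j := by
    rcases eq_or_ne j b with rfl | hj
    · simp [relativeGain]
    · have := hb j hj
      rw [sub_zero, sub_zero] at this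
      rw [relativeGain, if_pos this, indicator_of_mem (by exact hj), receivedPower_zero]
      ring
  have hs' : Summable fun j => receivedPower β x h 0 j := by simpa only [receivedPower_zero]
  have hsum : ∑' j, ENNReal.ofReal (relativeGain β z ‖x b‖ (x j) * h j) =
      ENNReal.ofReal (z * ‖x b‖ ^ β * interference β x h 0 b) := by
    rw [← ENNReal.ofReal_tsum_of_nonneg
      (fun j => mul_nonneg (relativeGain_nonneg hz.le hr.le _) (hh j).le)]
    · simp_rw [hterm]
      rw [tsum_mul_left, ← tsum_subtype]
      rfl
    · simp_rw [hterm]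
      exact (hs'.indicator _).mul_left _
  rw [hsum, ← ENNReal.ofReal_add (by positivity) (by positivity),
    ENNReal.ofReal_lt_ofReal_iff (hh b), sinr, receivedPower_zero, lt_div_iff₀ (by positivity),
    Real.rpow_neg hr.le, ← div_eq_mul_inv, lt_div_iff₀ (by positivity)]
  have : z * σ ^ 2 * ‖x b‖ ^ β + z * ‖x b‖ ^ β * interference β x h 0 b =
    z * (interference β x h 0 b + σ ^ 2) * ‖x b‖ ^ β := by ring
  rw [this]

/-- The term of index b vanishes, so h b need not be measurable. This makes the lemma usable for the
σ-algebra generated by the other fadings. -/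
lemma measurable_tsum_relativeGain {Ω : Type*} [MeasurableSpace Ω] {h : ℕ → Ω → ℝ} {b : ℕ}
    (hm : ∀ j, j ≠ b → Measurable (h j)) (z : ℝ) (c : ℝ≥0∞) :
    Measurable fun ω => c +
      ∑' j, ENNReal.ofReal (relativeGain β z ‖x b‖ (x j) * h j ω) := by
  refine Measurable.const_add (Measurable.tsum fun j => ?_) _
  rcases eq_or_ne j b with rfl | hj
  · simp [relativeGain]
  · have := hm j hj
    fun_prop

variable {Ω : Type*} [MeasurableSpace Ω] {P : Measure Ω}
  {h : ℕ → Ω → ℝ}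

lemma ae_fading (hm : ∀ i, Measurable (h i)) (hh : ∀ i, HasLaw (h i) (expMeasure 1) P)
    (hx : IsRegular β x) (hβ : 2 < β) :
    ∀ᵐ ω ∂P, (∀ j, 0 < h j ω) ∧ Summable fun j => h j ω * ‖x j‖ ^ (-β) := by
  have h1 : ∀ᵐ ω ∂P, ∀ j, 0 < h j ω :=
    ae_all_iff.mpr fun j => ae_pos_of_hasLaw_expMeasure (hh j)
  have hmeas (j : ℕ) : Measurable fun ω => ENNReal.ofReal (h j ω * ‖x j‖ ^ (-β)) := by
    have := hm j; fun_prop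
  have h2 : ∀ᵐ ω ∂P, ∑' j, ENNReal.ofReal (h j ω * ‖x j‖ ^ (-β)) < ∞ := by
    refine ae_lt_top (Measurable.tsum hmeas) ?_
    rw [lintegral_tsum fun j => (hmeas j).aemeasurable]
    have (j : ℕ) : ∫⁻ ω, ENNReal.ofReal (h j ω * ‖x j‖ ^ (-β)) ∂P =
        (∫⁻ y, ENNReal.ofReal y ∂expMeasure 1) * ENNReal.ofReal (‖x j‖ ^ (-β)) := by
      simp_rw [fun ω => ENNReal.ofReal_mul' (p := h j ω) (q := ‖x j‖ ^ (-β)) (by positivity)]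
      rw [lintegral_mul_const _ (hm j).ennreal_ofReal,
        ← (hh j).lintegral_comp (f := ENNReal.ofReal) (by fun_prop)]
    simp_rw [this]
    rw [ENNReal.tsum_mul_left]
    refine ENNReal.mul_ne_top lintegral_ofReal_expMeasure_lt_top.ne ?_
    exact (hx.summable_norm hβ).tsum_ofReal_ne_top
  filter_upwards [h1, h2] with ω hω1 hω2
  refine ⟨hω1, (ENNReal.summable_toReal hω2.ne).congr fun j => ENNReal.toReal_ofReal ?_⟩
  have := (hω1 j).le
  positivity

/-- The conditional probability of coverage, given the base stations. -/
lemma measure_lt_sinr [IsProbabilityMeasure P] (hm : ∀ i, Measurable (h i))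
    (hh : ∀ i, HasLaw (h i) (expMeasure 1) P) (hind : iIndepFun h P)
    (hx : IsRegular β x) (hβ : 2 < β) {b : ℕ} (hb : IsNearest x 0 b)
    {z : ℝ} (hz : 0 < z) :
    P {ω | z < sinr β σ x (fun j => h j ω) 0 b} =
      expNeg (ENNReal.ofReal (z * σ ^ 2 * ‖x b‖ ^ β) +
        ∑' j, ENNReal.ofReal (Real.log (1 + relativeGain β z ‖x b‖ (x j)))) := by
  set c := ENNReal.ofReal (z * σ ^ 2 * ‖x b‖ ^ β)
  let T : Ω → ℝ≥0∞ := fun ω =>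
    c + ∑' j, ENNReal.ofReal (relativeGain β z ‖x b‖ (x j) * h j ω)
  have hT : Measurable T := measurable_tsum_relativeGain (fun j _ => hm j) _ _
  have hTind : IndepFun T (h b) P := by
    rw [IndepFun_iff_Indep]
    have h1 := indep_iSup_of_disjoint (fun i => (hm i).comap_le) hind
      (S := {b}ᶜ) (T := {b}) disjoint_compl_left
    refine indep_of_indep_of_le_left (indep_of_indep_of_le_right h1 ?_) ?_
    · exact le_iSup₂_of_le (f := fun i (_ : i ∈ ({b} : Set ℕ)) =>
        MeasurableSpace.comap (h i) inferInstance) b rfl le_rfl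
    · rw [← measurable_iff_comap_le]
      -- The ambient σ-algebra is replaced by the one generated by h j for j ≠ b, which is
      -- independent of h b.
      refine @measurable_tsum_relativeGain β x Ω (_) h b (fun j hj => ?_) z c
      rw [measurable_iff_comap_le]
      exact le_iSup₂_of_le (f := fun i (_ : i ∈ ({b}ᶜ : Set ℕ)) =>
        MeasurableSpace.comap (h i) inferInstance) j hj le_rfl
  calc P {ω | z < sinr β σ x (fun j => h j ω) 0 b}
      = P {ω | T ω < ENNReal.ofReal (h b ω)} := by
        refine measure_congr ?_
        filter_upwards [ae_fading hm hh hx hβ] with ω hω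
        exact propext (lt_sinr_iff hx hω.1 hω.2 hb hz)
    _ = ∫⁻ ω, expNeg (T ω) ∂P := measure_lt_of_indepFun (hm b) (hh b) hT hTind
    _ = _ := by
        simp only [T, expNeg_add]
        rw [lintegral_const_mul' _ _ (expNeg_ne_top _), lintegral_expNeg_tsum_mul hm hh hind
          fun j => relativeGain_nonneg hz.le (norm_nonneg _) _]

end Fading

/-! ### The radial interference integral -/

section Radial

variable {β z r : ℝ}

/-- The coefficient of `w` in the exponent of `ρ(z, w)` is `1 + gainIntegral β z`. -/
noncomputable def gainIntegral (β z : ℝ) : ℝ :=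
  2 * z ^ (2 / β) / β * ∫ v in Ioi (1 / z), v ^ (2 / β - 1) / (1 + v)

lemma rho_eq (lam β σ z w : ℝ) : rho lam β σ z w =
    Real.exp (-(σ ^ 2 * z * (w / (Real.pi * lam)) ^ (β / 2)) - w * (1 + gainIntegral β z)) := rfl

lemma two_div_lt_one (hβ : 2 < β) : 2 / β < 1 := (div_lt_one (by linarith)).mpr hβ

lemma integrableOn_rpow_div_one_add (hβ : 2 < β) {c : ℝ} (hc : 0 < c) :
    IntegrableOn (fun v : ℝ => v ^ (2 / β - 1) / (1 + v)) (Ioi c) := by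
  have h := two_div_lt_one hβ
  have h1 : IntegrableOn (fun v : ℝ => v ^ (2 / β - 2)) (Ioi c) :=
    integrableOn_Ioi_rpow_of_lt (by linarith) hc
  refine Integrable.mono' h1 (Measurable.aestronglyMeasurable (by fun_prop)) ?_
  filter_upwards [self_mem_ae_restrict measurableSet_Ioi] with v hv
  have hv0 : 0 < v := hc.trans hv
  rw [Real.norm_of_nonneg (by positivity), div_le_iff₀ (by positivity)]
  have : v ^ (2 / β - 1) = v ^ (2 / β - 2) * v := by
    rw [← Real.rpow_add_one hv0.ne']; congr 1; ring
  rw [this]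
  have := Real.rpow_nonneg hv0.le (2 / β - 2)
  nlinarith

lemma setIntegral_rpow_div_one_add_nonneg (c : ℝ) (hc : 0 ≤ c) :
    0 ≤ ∫ v in Ioi c, v ^ (2 / β - 1) / (1 + v) :=
  setIntegral_nonneg measurableSet_Ioi fun v hv => by
    have : 0 < v := lt_of_le_of_lt hc hv
    positivity

lemma gainIntegral_nonneg (hβ : 2 < β) (hz : 0 < z) : 0 ≤ gainIntegral β z := by
  have : 0 < β := by linarith
  have := setIntegral_rpow_div_one_add_nonneg (β := β) (1 / z) (by positivity)
  rw [gainIntegral]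
  positivity

lemma integrableOn_div_one_add_rpow (hβ : 2 < β) {c : ℝ} (hc : 0 < c) (hr : 0 < r) :
    IntegrableOn (fun t : ℝ => t / (1 + c * t ^ β)) (Ioi r) := by
  have h1 : IntegrableOn (fun t : ℝ => c⁻¹ * t ^ (1 - β)) (Ioi r) :=
    (integrableOn_Ioi_rpow_of_lt (by linarith) hr).const_mul _
  refine Integrable.mono' h1 (Measurable.aestronglyMeasurable (by fun_prop)) ?_
  filter_upwards [self_mem_ae_restrict measurableSet_Ioi] with t ht
  have ht0 : 0 < t := hr.trans ht
  rw [Real.norm_of_nonneg (by positivity), Real.rpow_sub ht0, Real.rpow_one, inv_mul_eq_div,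
    div_div, div_le_div_iff₀ (by positivity) (by positivity)]
  nlinarith

/-- Substitute v = c t^β with c = 1/(z r^β); the lower end t = r becomes v = 1/z. -/
lemma setIntegral_div_one_add_rpow (hβ : 2 < β) (hz : 0 < z) (hr : 0 < r) :
    2 * ∫ t in Ioi r, t / (1 + (z * r ^ β)⁻¹ * t ^ β) = r ^ 2 * gainIntegral β z := by
  have hβ0 : 0 < β := by linarith
  have hrβ : 0 < r ^ β := by positivity
  set c := (z * r ^ β)⁻¹ with hc
  have hc0 : 0 < c := by positivity
  set φ : ℝ → ℝ := fun v => v ^ (2 / β - 1) / (1 + v) with hφ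
  have h1 := integral_comp_mul_left_Ioi φ (r ^ β) hc0
  have hcr : c * r ^ β = 1 / z := by rw [hc]; field_simp
  have h2 := integral_comp_rpow_Ioi_of_pos' (g := fun u => φ (c * u)) hβ0 hrβ.le
  rw [Real.rpow_rpow_inv hr.le hβ0.ne', h1, hcr] at h2
  have hpc : c ^ (-(2 / β)) = z ^ (2 / β) * r ^ 2 := by
    rw [hc, Real.inv_rpow (by positivity), ← Real.rpow_neg (by positivity), neg_neg,
      Real.mul_rpow hz.le hrβ.le, ← Real.rpow_mul hr.le, mul_div_cancel₀ _ hβ0.ne',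
      Real.rpow_two]
  have h3 : ∫ t in Ioi r, (β * t ^ (β - 1)) • φ (c * t ^ β) =
      (β * c ^ (2 / β - 1)) * ∫ t in Ioi r, t / (1 + c * t ^ β) := by
    rw [← integral_const_mul]
    refine setIntegral_congr_fun measurableSet_Ioi fun t ht => ?_
    have ht0 : 0 < t := hr.trans ht
    have e1 : t ^ (β - 1) * (t ^ β) ^ (2 / β - 1) = t := by
      rw [← Real.rpow_mul ht0.le, ← Real.rpow_add ht0]
      have : β - 1 + β * (2 / β - 1) = 1 := by field_simp; ring
      rw [this, Real.rpow_one]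
    simp only [hφ, smul_eq_mul]
    rw [Real.mul_rpow hc0.le (by positivity)]
    rw [mul_div_assoc', mul_div_assoc']
    congr 1
    calc _ = β * c ^ (2 / β - 1) * (t ^ (β - 1) * (t ^ β) ^ (2 / β - 1)) := by ring
      _ = _ := by rw [e1]
  rw [h3, smul_eq_mul] at h2
  have hcc : c ^ (2 / β - 1) * c ^ (-(2 / β)) = c⁻¹ := by
    rw [← Real.rpow_add hc0, ← Real.rpow_neg_one]; congr 1; ring
  have hcp : 0 < c ^ (2 / β - 1) := by positivity
  rw [← hcc, hpc] at h2
  have h4 : β * ∫ t in Ioi r, t / (1 + c * t ^ β) =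
      z ^ (2 / β) * r ^ 2 * ∫ v in Ioi (1 / z), φ v := by
    refine mul_left_cancel₀ hcp.ne' ?_
    linear_combination h2
  have h5 : ∫ t in Ioi r, t / (1 + c * t ^ β) =
      z ^ (2 / β) * r ^ 2 * (∫ v in Ioi (1 / z), φ v) / β := by
    rw [eq_div_iff hβ0.ne', ← h4, mul_comm]
  rw [gainIntegral, h5]
  ring

/-- For a gain g > 0 the integrand is 1 - 1/(1+g) = 1/(1 + 1/g), with 1/g = (z r^β)⁻¹|y|^β; it
vanishes where the gain does. Polar coordinates reduce it to the radial integral. -/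
lemma lintegral_one_sub_expNeg_relativeGain (hβ : 2 < β) (hz : 0 < z) (hr : 0 < r) :
    ∫⁻ y : Plane, (1 - expNeg (ENNReal.ofReal (Real.log (1 + relativeGain β z r y)))) =
      ENNReal.ofReal (Real.pi * r ^ 2 * gainIntegral β z) := by
  set k : ℝ → ℝ := (Ioi r).indicator fun t => 1 / (1 + (z * r ^ β)⁻¹ * t ^ β) with hk
  have hrβ : 0 < r ^ β := by positivity
  have hk0 (t : ℝ) : 0 ≤ k t := by
    refine indicator_nonneg (fun t ht => ?_) t
    have : 0 < t := hr.trans ht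
    positivity
  have h1 (y : Plane) : 1 - expNeg (ENNReal.ofReal (Real.log (1 + relativeGain β z r y))) =
      ENNReal.ofReal (k ‖y‖) := by
    rw [expNeg_log (by linarith [relativeGain_nonneg (β := β) hz.le hr.le y]),
      ← ENNReal.ofReal_one, ← ENNReal.ofReal_sub _
        (inv_nonneg.mpr (by linarith [relativeGain_nonneg (β := β) hz.le hr.le y]))]
    congr 1
    rw [relativeGain, hk]
    split_ifs with h
    · have hy : 0 < ‖y‖ := hr.trans h
      have : 0 < ‖y‖ ^ β := by positivity
      rw [indicator_of_mem (by exact h), Real.rpow_neg hy.le]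
      field_simp
      ring
    · rw [indicator_of_notMem (by exact h)]; simp
  have hmul (t : ℝ) : t ^ 1 • k t =
      (Ioi r).indicator (fun t => t / (1 + (z * r ^ β)⁻¹ * t ^ β)) t := by
    by_cases h : t ∈ Ioi r
    · rw [hk, indicator_of_mem h, indicator_of_mem h, pow_one, smul_eq_mul, mul_one_div]
    · rw [hk, indicator_of_notMem h, indicator_of_notMem h, smul_zero]
  have hsub : Ioi r ∩ Ioi 0 = Ioi r := inter_eq_left.mpr (Ioi_subset_Ioi hr.le)
  have hint : Integrable (fun y : Plane => k ‖y‖) := by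
    rw [integrable_fun_norm_addHaar]
    simp only [finrank_euclideanSpace, Fintype.card_fin, Nat.add_one_sub_one, hmul]
    rw [integrableOn_indicator_iff measurableSet_Ioi, hsub]
    exact integrableOn_div_one_add_rpow hβ (by positivity) hr
  have hball : (volume : Measure Plane).real (Metric.ball 0 1) = Real.pi := by
    rw [measureReal_def, EuclideanSpace.volume_ball_fin_two]
    simp [Real.pi_pos.le]
  simp_rw [h1]
  rw [← ofReal_integral_eq_lintegral_ofReal hint (Eventually.of_forall fun y => hk0 _),
    integral_fun_norm_addHaar]
  simp only [finrank_euclideanSpace, Fintype.card_fin, Nat.add_one_sub_one, hmul, hball]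
  rw [setIntegral_indicator measurableSet_Ioi, inter_comm, hsub]
  congr 1
  rw [mul_assoc, ← setIntegral_div_one_add_rpow hβ hz hr, nsmul_eq_mul, smul_eq_mul]
  push_cast
  ring

end Radial

/-! ### Integrability of ρ(z, w)/(1 + z) -/

section Rho

variable {lam β σ z : ℝ}

lemma lintegral_expMeasure_one {f : ℝ → ℝ≥0∞} (hf : Measurable f) :
    ∫⁻ w, f w ∂expMeasure 1 = ∫⁻ w in Ioi 0, ENNReal.ofReal (Real.exp (-w)) * f w := by
  rw [lintegral_expMeasure hf, ← lintegral_add_compl _ (measurableSet_Ici (a := (0 : ℝ)))]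
  have h1 : ∫⁻ w in (Ici (0 : ℝ))ᶜ, exponentialPDF 1 w * f w = 0 := by
    rw [setLIntegral_congr_fun measurableSet_Ici.compl (g := fun _ => 0)]
    · simp
    · intro w hw
      simp only [compl_Ici, mem_Iio] at hw
      simp [exponentialPDF_of_neg hw]
  rw [h1, add_zero, setLIntegral_congr Ioi_ae_eq_Ici.symm]
  refine setLIntegral_congr_fun measurableSet_Ioi fun w hw => ?_
  simp only [exponentialPDF_of_nonneg (le_of_lt (show 0 < w from hw)), one_mul]

/-- The factor exp(-w) in ρ is read as the unit exponential density; w will be πλ times the squared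
nearest distance. -/
lemma lintegral_rho (hlam : 0 < lam) (hβ : 2 < β) (hz : 0 < z) :
    ∫⁻ w in Ioi 0, ENNReal.ofReal (rho lam β σ z w) =
      ∫⁻ w, expNeg (ENNReal.ofReal (z * σ ^ 2 * (w / (Real.pi * lam)) ^ (β / 2) +
        w * gainIntegral β z)) ∂expMeasure 1 := by
  rw [lintegral_expMeasure_one (by fun_prop)]
  refine setLIntegral_congr_fun measurableSet_Ioi fun w hw => ?_
  have hw0 : 0 < w := hw
  have := gainIntegral_nonneg hβ hz
  have := Real.pi_pos
  simp only [rho_eq]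
  rw [expNeg_ofReal (by positivity), ← ENNReal.ofReal_mul (by positivity), ← Real.exp_add]
  congr 2; ring

lemma measurable_gainIntegral (β : ℝ) : Measurable (gainIntegral β) := by
  have h : Measurable fun z : ℝ => ∫ v in Ioi (1 / z), v ^ (2 / β - 1) / (1 + v) := by
    have hS : MeasurableSet {p : ℝ × ℝ | 1 / p.1 < p.2} :=
      measurableSet_lt (by fun_prop) measurable_snd
    have hm : Measurable ({p : ℝ × ℝ | 1 / p.1 < p.2}.indicator
        fun p => p.2 ^ (2 / β - 1) / (1 + p.2)) := Measurable.indicator (by fun_prop) hS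
    have h1 := (hm.stronglyMeasurable.integral_prod_right' (ν := volume)).measurable
    have h2 : (fun z : ℝ => ∫ v in Ioi (1 / z), v ^ (2 / β - 1) / (1 + v)) = fun z : ℝ => ∫ v,
        {p : ℝ × ℝ | 1 / p.1 < p.2}.indicator (fun p => p.2 ^ (2 / β - 1) / (1 + p.2)) (z, v) := by
      funext z
      rw [← integral_indicator measurableSet_Ioi]
      rfl
    rwa [h2]
  unfold gainIntegral
  fun_prop

lemma measurable_rho (lam β σ : ℝ) : Measurable fun p : ℝ × ℝ => rho lam β σ p.1 p.2 := by
  have := measurable_gainIntegral β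
  simp only [rho_eq]
  fun_prop

/-- For z ≥ 1 the half-line (1/z, ∞) contains (1, ∞), so the integral is bounded below by a positive
constant. -/
lemma gainIntegral_ge (hβ : 2 < β) :
    ∃ c, 0 < c ∧ ∀ z, 1 ≤ z → c * z ^ (2 / β) ≤ gainIntegral β z := by
  have hβ0 : 0 < β := by linarith
  have hpos : 0 < ∫ v in Ioi (1 : ℝ), v ^ (2 / β - 1) / (1 + v) := by
    rw [setIntegral_pos_iff_support_of_nonneg_ae]
    · refine lt_of_lt_of_le ?_ (measure_mono (s := Ioi (1 : ℝ)) fun v hv => ⟨?_, hv⟩)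
      · simp
      · have : (0 : ℝ) < v := one_pos.trans hv
        simp only [Function.mem_support]
        positivity
    · filter_upwards [self_mem_ae_restrict measurableSet_Ioi] with v hv
      have : (0 : ℝ) < v := one_pos.trans hv
      simp only [Pi.zero_apply]
      positivity
    · exact integrableOn_rpow_div_one_add hβ one_pos
  refine ⟨2 / β * ∫ v in Ioi (1 : ℝ), v ^ (2 / β - 1) / (1 + v), by positivity, fun z hz => ?_⟩
  have hz0 : 0 < z := by linarith
  have hle : ∫ v in Ioi (1 : ℝ), v ^ (2 / β - 1) / (1 + v) ≤
      ∫ v in Ioi (1 / z), v ^ (2 / β - 1) / (1 + v) := by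
    refine setIntegral_mono_set (integrableOn_rpow_div_one_add hβ (by positivity)) ?_ ?_
    · filter_upwards [self_mem_ae_restrict measurableSet_Ioi] with v hv
      have : (0 : ℝ) < v := lt_trans (by positivity) hv
      simp only [Pi.zero_apply]
      positivity
    · exact (Ioi_subset_Ioi ((div_le_one hz0).mpr hz)).eventuallyLE
  rw [gainIntegral]
  calc _ = 2 * z ^ (2 / β) / β * ∫ v in Ioi (1 : ℝ), v ^ (2 / β - 1) / (1 + v) := by ring
    _ ≤ _ := by gcongr

/-- Dropping the noise term leaves the Laplace transform of a unit exponential variable. -/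
lemma lintegral_rho_le (hlam : 0 < lam) (hβ : 2 < β) (hz : 0 < z) :
    ∫⁻ w in Ioi 0, ENNReal.ofReal (rho lam β σ z w) ≤
      ENNReal.ofReal (1 + gainIntegral β z)⁻¹ := by
  have hA := gainIntegral_nonneg hβ hz
  rw [← expNeg_log (by linarith), ← lintegral_expNeg_mul_expMeasure hA, lintegral_rho hlam hβ hz,
    lintegral_expMeasure_one (by fun_prop), lintegral_expMeasure_one (by fun_prop)]
  refine setLIntegral_mono' measurableSet_Ioi fun w hw => ?_
  have hw0 : 0 < w := hw
  have := Real.pi_pos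
  gcongr
  refine expNeg_antitone (ENNReal.ofReal_le_ofReal ?_)
  have : 0 ≤ z * σ ^ 2 * (w / (Real.pi * lam)) ^ (β / 2) := by positivity
  linarith

/-- The integrand is at most 1 on (0, 1] and O(z^(-1 - 2/β)) beyond. -/
lemma lintegral_inv_gainIntegral_lt_top (hβ : 2 < β) :
    ∫⁻ z in Ioi (0 : ℝ), ENNReal.ofReal (1 + gainIntegral β z)⁻¹ * ENNReal.ofReal (1 / (1 + z)) <
      ∞ := by
  obtain ⟨c, hc, hge⟩ := gainIntegral_ge hβ
  have hβ0 : 0 < β := by linarith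
  rw [← Ioc_union_Ioi_eq_Ioi zero_le_one]
  refine (lintegral_union_le _ _ _).trans_lt (ENNReal.add_lt_top.mpr ⟨?_, ?_⟩)
  · calc _ ≤ ∫⁻ z in Ioc (0 : ℝ) 1, 1 := by
          refine setLIntegral_mono' measurableSet_Ioc fun z hz => ?_
          have := gainIntegral_nonneg hβ hz.1
          refine mul_le_one' (ENNReal.ofReal_le_one.mpr (inv_le_one_of_one_le₀ (by linarith)))
            (ENNReal.ofReal_le_one.mpr ?_)
          rw [div_le_one (by linarith [hz.1])]
          linarith [hz.1]
      _ < ∞ := by simp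
  · have hint : IntegrableOn (fun z : ℝ => c⁻¹ * z ^ (-1 - 2 / β)) (Ioi 1) :=
      (integrableOn_Ioi_rpow_of_lt (by have : 0 < 2 / β := by positivity
                                       linarith) one_pos).const_mul _
    calc _ ≤ ∫⁻ z in Ioi (1 : ℝ), ENNReal.ofReal (c⁻¹ * z ^ (-1 - 2 / β)) := by
          refine setLIntegral_mono' measurableSet_Ioi fun z hz => ?_
          have hz1 : 1 < z := hz
          have hz0 : 0 < z := by linarith
          have h1 := hge z hz1.le
          have h2 : 0 < z ^ (2 / β) := by positivity
          have h3 : 0 < c * z ^ (2 / β) := by positivity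
          rw [← ENNReal.ofReal_mul (inv_nonneg.mpr (by linarith))]
          refine ENNReal.ofReal_le_ofReal ?_
          calc (1 + gainIntegral β z)⁻¹ * (1 / (1 + z))
              ≤ (c * z ^ (2 / β))⁻¹ * (1 / z) := by
                gcongr <;> linarith
            _ = c⁻¹ * z ^ (-1 - 2 / β) := by
                rw [Real.rpow_sub hz0, Real.rpow_neg_one]
                field_simp
      _ < ∞ := hint.lintegral_lt_top

lemma lintegral_rho_div (hlam : 0 < lam) (hβ : 2 < β) :
    ∫⁻ z in Ioi (0 : ℝ), (∫⁻ w in Ioi 0, ENNReal.ofReal (rho lam β σ z w)) *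
      ENNReal.ofReal (1 / (1 + z)) < ∞ :=
  (setLIntegral_mono' measurableSet_Ioi fun z hz => by
    gcongr; exact lintegral_rho_le hlam hβ hz).trans_lt (lintegral_inv_gainIntegral_lt_top hβ)

lemma rho_div_nonneg (lam β σ w : ℝ) (hz : 0 < z) : 0 ≤ rho lam β σ z w / (1 + z) := by
  rw [rho]
  positivity

lemma lintegral_prod_rho_div (lam β σ : ℝ) :
    ∫⁻ p in Ioi (0 : ℝ) ×ˢ Ioi (0 : ℝ), ENNReal.ofReal (rho lam β σ p.1 p.2 / (1 + p.1)) =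
      ∫⁻ z in Ioi (0 : ℝ), (∫⁻ w in Ioi 0, ENNReal.ofReal (rho lam β σ z w)) *
        ENNReal.ofReal (1 / (1 + z)) := by
  have hm : Measurable fun p : ℝ × ℝ => ENNReal.ofReal (rho lam β σ p.1 p.2 / (1 + p.1)) := by
    have := measurable_rho lam β σ
    fun_prop
  rw [Measure.volume_eq_prod, ← Measure.prod_restrict, lintegral_prod _ hm.aemeasurable]
  refine setLIntegral_congr_fun measurableSet_Ioi fun z hz => ?_
  have hm' : Measurable fun w => ENNReal.ofReal (rho lam β σ z w) :=
    ((measurable_rho lam β σ).comp measurable_prodMk_left).ennreal_ofReal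
  simp only
  rw [← lintegral_mul_const _ hm']
  refine lintegral_congr fun w => ?_
  have hz0 : (0 : ℝ) < z := hz
  rw [← ENNReal.ofReal_mul (by rw [rho]; positivity), mul_one_div]

lemma integrableOn_rho_div (hlam : 0 < lam) (hβ : 2 < β) :
    IntegrableOn (fun p : ℝ × ℝ => rho lam β σ p.1 p.2 / (1 + p.1)) (Ioi 0 ×ˢ Ioi 0) := by
  have hm := measurable_rho lam β σ
  refine ⟨(by fun_prop : Measurable fun p : ℝ × ℝ =>
    rho lam β σ p.1 p.2 / (1 + p.1)).aestronglyMeasurable, ?_⟩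
  rw [hasFiniteIntegral_iff_ofReal, lintegral_prod_rho_div]
  · exact lintegral_rho_div hlam hβ
  · filter_upwards [self_mem_ae_restrict (measurableSet_Ioi.prod measurableSet_Ioi)] with p hp
    exact rho_div_nonneg _ _ _ _ hp.1

lemma ofReal_rateIntegral (hlam : 0 < lam) (hβ : 2 < β) :
    ENNReal.ofReal (rateIntegral lam β σ) =
      ∫⁻ z in Ioi (0 : ℝ), (∫⁻ w in Ioi 0, ENNReal.ofReal (rho lam β σ z w)) *
        ENNReal.ofReal (1 / (1 + z)) := by
  have hint := integrableOn_rho_div (σ := σ) hlam hβ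
  rw [← lintegral_prod_rho_div, ← ofReal_integral_eq_lintegral_ofReal hint, rateIntegral]
  · congr 1
    rw [IntegrableOn, Measure.volume_eq_prod, ← Measure.prod_restrict] at hint
    rw [Measure.volume_eq_prod, ← Measure.prod_restrict, integral_prod_symm _ hint]
  · filter_upwards [self_mem_ae_restrict (measurableSet_Ioi.prod measurableSet_Ioi)] with p hp
    exact rho_div_nonneg _ _ _ _ hp.1

end Rho

/-! ### Distance to the nearest base station -/

section NearestDist

variable {β σ : ℝ} {x : ℕ → Plane}

/-- The distance from the origin to the nearest base station. -/
noncomputable def nearestDist (x : ℕ → Plane) : ℝ := ⨅ i, ‖x i‖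

lemma bddBelow_range_norm (x : ℕ → Plane) : BddBelow (range fun i => ‖x i‖) :=
  ⟨0, by rintro _ ⟨i, rfl⟩; exact norm_nonneg _⟩

lemma nearestDist_nonneg (x : ℕ → Plane) : 0 ≤ nearestDist x :=
  le_ciInf fun _ => norm_nonneg _

lemma measurable_nearestDist : Measurable nearestDist :=
  Measurable.iInf fun i => (measurable_pi_apply i).norm

lemma IsNearest.nearestDist_eq {b : ℕ} (hb : IsNearest x 0 b) : nearestDist x = ‖x b‖ := by
  refine le_antisymm (ciInf_le (bddBelow_range_norm x) b) (le_ciInf fun j => ?_)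
  rcases eq_or_ne j b with rfl | hj
  · exact le_rfl
  · simpa using (hb j hj).le

/-- The infimum is attained, so strict inequality passes to it. -/
lemma IsRegular.lt_nearestDist_iff (hx : IsRegular β x) (hβ : 2 < β) {a : ℝ} :
    a < nearestDist x ↔ ∀ i, a < ‖x i‖ := by
  refine ⟨fun h i => h.trans_le (ciInf_le (bddBelow_range_norm x) i), fun h => ?_⟩
  obtain ⟨b, hb⟩ := hx.exists_isNearest hβ
  rw [hb.nearestDist_eq]
  exact h b

lemma IsRegular.nearestDist_pos (hx : IsRegular β x) (hβ : 2 < β) : 0 < nearestDist x :=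
  (hx.lt_nearestDist_iff hβ).mpr hx.norm_pos

end NearestDist

/-! ### Averaging the coverage over the Poisson process -/

section Coverage

variable {lam β σ z : ℝ}

lemma measurable_log_relativeGain (β z : ℝ) : Measurable fun p : ℝ × Plane =>
    ENNReal.ofReal (Real.log (1 + relativeGain β z p.1 p.2)) := by
  have h : Measurable fun p : ℝ × Plane => relativeGain β z p.1 p.2 := by
    unfold relativeGain
    exact Measurable.ite (measurableSet_lt measurable_fst (by fun_prop)) (by fun_prop)
      measurable_const
  fun_prop

/-- The conditional probability that the signal-to-interference-plus-noise ratio exceeds `z`, if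
the nearest base station has distance `r` and the other ones are the points of `x` at a larger
distance. -/
noncomputable def coverage (β σ z r : ℝ) (x : ℕ → Plane) : ℝ≥0∞ :=
  expNeg (ENNReal.ofReal (z * σ ^ 2 * r ^ β)) *
    expNeg (∑' j, ENNReal.ofReal (Real.log (1 + relativeGain β z r (x j))))

lemma measurable_coverage {α : Type*} [MeasurableSpace α] {r : α → ℝ} {Y : α → ℕ → Plane}
    (hr : Measurable r) (hY : Measurable Y) : Measurable fun a => coverage β σ z (r a) (Y a) := by
  unfold coverage
  refine Measurable.mul (by fun_prop) (Measurable.expNeg (Measurable.tsum fun j => ?_))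
  exact (measurable_log_relativeGain β z).comp (hr.prodMk ((measurable_pi_apply j).comp hY))

lemma coverage_le_one (β σ z r : ℝ) (x : ℕ → Plane) : coverage β σ z r x ≤ 1 :=
  mul_le_one' (expNeg_le_one _) (expNeg_le_one _)

/-- The mean of `coverage β σ z r X`. -/
noncomputable def meanCoverage (lam β σ z r : ℝ) : ℝ≥0∞ :=
  expNeg (ENNReal.ofReal (z * σ ^ 2 * r ^ β)) *
    expNeg (ENNReal.ofReal (lam * (Real.pi * r ^ 2 * gainIntegral β z)))

lemma continuous_meanCoverage (hβ : 2 < β) : Continuous (meanCoverage lam β σ z) := by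
  have h1 : Continuous fun r : ℝ => r ^ β := Real.continuous_rpow_const (by linarith)
  have h2 : Continuous fun r : ℝ => ENNReal.ofReal (z * σ ^ 2 * r ^ β) :=
    ENNReal.continuous_ofReal.comp (by fun_prop)
  have h3 : Continuous fun r : ℝ => ENNReal.ofReal (lam * (Real.pi * r ^ 2 * gainIntegral β z)) :=
    ENNReal.continuous_ofReal.comp (by fun_prop)
  rw [continuous_iff_continuousAt]
  intro r
  exact ENNReal.Tendsto.mul ((continuous_expNeg.comp h2).tendsto r) (Or.inr (expNeg_ne_top _))
    ((continuous_expNeg.comp h3).tendsto r) (Or.inr (expNeg_ne_top _))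

/-- Approach from above is essential: a point at distance exactly R, such as the serving station,
has gain 0 for every r ≥ R but a positive gain for r < R. Summability of the path losses dominates
the series. -/
lemma IsRegular.tendsto_coverage {x : ℕ → Plane} (hx : IsRegular β x) (hβ : 2 < β) (hz : 0 < z)
    {R : ℝ} (hR : 0 < R) {r : ℕ → ℝ} (hle : ∀ n, R ≤ r n) (hr : Tendsto r atTop (𝓝 R)) :
    Tendsto (fun n => coverage β σ z (r n) x) atTop (𝓝 (coverage β σ z R x)) := by
  have hβ0 : 0 < β := by linarith
  have hrpow : Tendsto (fun n => r n ^ β) atTop (𝓝 (R ^ β)) :=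
    ((Real.continuous_rpow_const hβ0.le).tendsto R).comp hr
  have hr0 (n : ℕ) : 0 < r n := hR.trans_le (hle n)
  have hterm (y : Plane) : Tendsto (fun n => Real.log (1 + relativeGain β z (r n) y)) atTop
      (𝓝 (Real.log (1 + relativeGain β z R y))) := by
    have hg : Tendsto (fun n => relativeGain β z (r n) y) atTop (𝓝 (relativeGain β z R y)) := by
      by_cases hy : R < ‖y‖
      · rw [relativeGain, if_pos hy]
        refine Tendsto.congr' ?_ ((hrpow.const_mul z).mul_const _)
        filter_upwards [hr.eventually (gt_mem_nhds hy)] with n hn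
        rw [relativeGain, if_pos hn]
      · have h0 (s : ℝ) (hs : R ≤ s) : relativeGain β z s y = 0 :=
          if_neg (not_lt.mpr ((not_lt.mp hy).trans hs))
        rw [h0 R le_rfl]
        exact tendsto_const_nhds.congr fun n => (h0 _ (hle n)).symm
    have h1 := relativeGain_nonneg (β := β) hz.le hR.le y
    exact ((Real.continuousAt_log (by linarith)).tendsto).comp (hg.const_add 1)
  have hlog (s : ℝ) (hs : 0 < s) (y : Plane) : 0 ≤ Real.log (1 + relativeGain β z s y) :=
    Real.log_nonneg (by linarith [relativeGain_nonneg (β := β) hz.le hs.le y])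
  have hloglt (s : ℝ) (hs : 0 < s) (j : ℕ) :
      Real.log (1 + relativeGain β z s (x j)) ≤ z * s ^ β * ‖x j‖ ^ (-β) := by
    have h0 := relativeGain_nonneg (β := β) hz.le hs.le (x j)
    have h1 := Real.log_le_sub_one_of_pos (show 0 < 1 + relativeGain β z s (x j) by linarith)
    have h2 : relativeGain β z s (x j) ≤ z * s ^ β * ‖x j‖ ^ (-β) := by
      rw [relativeGain]; split_ifs
      · exact le_rfl
      · positivity
    linarith
  have hsum (s : ℝ) (hs : 0 < s) :
      ∑' j, ENNReal.ofReal (Real.log (1 + relativeGain β z s (x j))) =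
      ENNReal.ofReal (∑' j, Real.log (1 + relativeGain β z s (x j))) :=
    (ENNReal.ofReal_tsum_of_nonneg (fun j => hlog s hs _)
      (((hx.summable_norm hβ).mul_left _).of_nonneg_of_le (fun j => hlog s hs _)
        (hloglt s hs))).symm
  have htsum : Tendsto (fun n => ∑' j, Real.log (1 + relativeGain β z (r n) (x j))) atTop
      (𝓝 (∑' j, Real.log (1 + relativeGain β z R (x j)))) := by
    refine tendsto_tsum_of_dominated_convergence
      (bound := fun j => z * (R + 1) ^ β * ‖x j‖ ^ (-β))
      ((hx.summable_norm hβ).mul_left _) (fun j => hterm _) ?_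
    filter_upwards [hr.eventually (gt_mem_nhds (lt_add_one R))] with n hn j
    rw [Real.norm_of_nonneg (hlog _ (hr0 n) _)]
    refine (hloglt _ (hr0 n) j).trans ?_
    have := hr0 n
    gcongr
  unfold coverage
  refine ENNReal.Tendsto.mul ((continuous_expNeg.tendsto _).comp
    ((ENNReal.continuous_ofReal.tendsto _).comp (hrpow.const_mul _))) (Or.inr (expNeg_ne_top _))
    ?_ (Or.inr (expNeg_ne_top _))
  refine (continuous_expNeg.tendsto _).comp ?_
  rw [hsum R hR]
  exact ((ENNReal.continuous_ofReal.tendsto _).comp htsum).congr fun n => (hsum _ (hr0 n)).symm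

variable {Ω : Type*} [MeasurableSpace Ω] {P : Measure Ω}
  {X : ℕ → Ω → Plane} {Λ : Measure Plane}

/-- The event of no point in the closed disc has indicator exp(-Σ ∞·1_D(x_i)). As F vanishes on D,
the two test functions have disjoint supports and the exponent of the Laplace functional splits. -/
lemma HasPoissonLaplace.setLIntegral_void (h : HasPoissonLaplace X Λ P)
    (hX : ∀ i, Measurable (X i)) (hreg : ∀ᵐ ω ∂P, IsRegular β fun i => X i ω) (hβ : 2 < β)
    {a : ℝ} {F : Plane → ℝ≥0∞} (hF : Measurable F) (hFa : ∀ y, ‖y‖ ≤ a → F y = 0) :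
    ∫⁻ ω in {ω | a < nearestDist fun i => X i ω}, expNeg (∑' i, F (X i ω)) ∂P =
      expNeg (Λ (Metric.closedBall 0 a)) * ∫⁻ ω, expNeg (∑' i, F (X i ω)) ∂P := by
  set D : Set Plane := Metric.closedBall 0 a with hD
  have hDm : MeasurableSet D := Metric.isClosed_closedBall.measurableSet
  have hS : MeasurableSet {ω | a < nearestDist fun i => X i ω} :=
    measurableSet_lt measurable_const (measurable_nearestDist.comp (measurable_pi_lambda _ hX))
  have hI : Measurable (D.indicator fun _ => (∞ : ℝ≥0∞)) := measurable_const.indicator hDm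
  rw [← lintegral_indicator hS]
  have h1 : ∀ᵐ ω ∂P, {ω | a < nearestDist fun i => X i ω}.indicator
      (fun ω => expNeg (∑' i, F (X i ω))) ω =
      expNeg (∑' i, (D.indicator (fun _ => ∞) (X i ω) + F (X i ω))) := by
    filter_upwards [hreg] with ω hω
    rw [ENNReal.tsum_add, expNeg_add]
    by_cases ha : a < nearestDist fun i => X i ω
    · rw [indicator_of_mem (by exact ha)]
      have : ∀ i, D.indicator (fun _ => (∞ : ℝ≥0∞)) (X i ω) = 0 := fun i => by
        refine indicator_of_notMem ?_ _
        simpa [hD] using (hω.lt_nearestDist_iff hβ).mp ha i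
      simp [this]
    · rw [indicator_of_notMem (by exact ha)]
      rw [hω.lt_nearestDist_iff hβ] at ha
      push Not at ha
      obtain ⟨i, hi⟩ := ha
      have : ∑' i, D.indicator (fun _ => (∞ : ℝ≥0∞)) (X i ω) = ∞ := by
        refine top_le_iff.mp (le_trans ?_ (ENNReal.le_tsum i))
        rw [indicator_of_mem]
        simpa [hD] using hi
      rw [this, expNeg_top, zero_mul]
  have hL := h (fun y => D.indicator (fun _ => ∞) y + F y) (hI.add hF)
  rw [lintegral_congr_ae h1, hL, h _ hF, ← expNeg_add]
  congr 1
  have h2 (y : Plane) : 1 - expNeg (D.indicator (fun _ => ∞) y + F y) =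
      D.indicator 1 y + (1 - expNeg (F y)) := by
    by_cases hy : y ∈ D
    · have : F y = 0 := hFa y (by simpa [hD] using hy)
      simp [hy, this]
    · simp [hy]
  simp_rw [h2]
  rw [lintegral_add_left (measurable_one.indicator hDm), lintegral_indicator_one hDm]

lemma HasPoissonLaplace.measure_lt_nearestDist [IsProbabilityMeasure P]
    (h : HasPoissonLaplace X Λ P) (hX : ∀ i, Measurable (X i))
    (hreg : ∀ᵐ ω ∂P, IsRegular β fun i => X i ω) (hβ : 2 < β)
    (a : ℝ) : P {ω | a < nearestDist fun i => X i ω} = expNeg (Λ (Metric.closedBall 0 a)) := by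
  have := h.setLIntegral_void hX hreg hβ (a := a) (F := fun _ => 0) measurable_const
    fun _ _ => rfl
  simpa using this

/-- Subtract the void identity for radius b from the one for radius a; both apply because F vanishes
up to b. This expresses that the points beyond b are independent of where in (a, b] the nearest
point lies. -/
lemma HasPoissonLaplace.setLIntegral_annulus [IsProbabilityMeasure P]
    (h : HasPoissonLaplace X Λ P) (hX : ∀ i, Measurable (X i))
    (hreg : ∀ᵐ ω ∂P, IsRegular β fun i => X i ω) (hβ : 2 < β)
    {a b : ℝ} (hab : a ≤ b) {F : Plane → ℝ≥0∞} (hF : Measurable F)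
    (hFb : ∀ y, ‖y‖ ≤ b → F y = 0) :
    ∫⁻ ω in {ω | a < nearestDist (fun i => X i ω) ∧ nearestDist (fun i => X i ω) ≤ b},
      expNeg (∑' i, F (X i ω)) ∂P =
      P {ω | a < nearestDist (fun i => X i ω) ∧ nearestDist (fun i => X i ω) ≤ b} *
        ∫⁻ ω, expNeg (∑' i, F (X i ω)) ∂P := by
  set S : Set Ω := {ω | a < nearestDist (fun i => X i ω) ∧ nearestDist (fun i => X i ω) ≤ b}
  set T : Set Ω := {ω | b < nearestDist fun i => X i ω} with hTdef
  have hT : MeasurableSet T :=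
    measurableSet_lt measurable_const (measurable_nearestDist.comp (measurable_pi_lambda _ hX))
  have hST : {ω | a < nearestDist fun i => X i ω} = S ∪ T := by
    ext ω
    constructor
    · intro hω
      rcases le_or_gt (nearestDist fun i => X i ω) b with h' | h'
      · exact Or.inl ⟨hω, h'⟩
      · exact Or.inr h'
    · rintro (hω | hω)
      · exact hω.1
      · exact hab.trans_lt hω
  have hd : Disjoint S T := by
    rw [Set.disjoint_left]
    exact fun ω h1 h2 => absurd h1.2 (not_le.mpr h2)
  set e := ∫⁻ ω, expNeg (∑' i, F (X i ω)) ∂P with he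
  have he1 : e ≤ 1 := (lintegral_mono fun ω => expNeg_le_one _).trans (by simp)
  have h1 := h.setLIntegral_void hX hreg hβ hF fun y hy => hFb y (hy.trans hab)
  have h2 := h.setLIntegral_void hX hreg hβ hF hFb
  rw [← h.measure_lt_nearestDist hX hreg hβ] at h1 h2
  rw [← hTdef] at h2
  rw [hST, lintegral_union hT hd, measure_union hd hT, add_mul, h2] at h1
  refine (ENNReal.add_left_inj (a := P T * e) ?_).mp h1
  exact ENNReal.mul_ne_top (measure_ne_top _ _) (ne_top_of_le_ne_top ENNReal.one_ne_top he1)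

lemma HasPoissonLaplace.lintegral_coverage_const (hlam : 0 < lam) (hβ : 2 < β) (hz : 0 < z)
    (h : HasPoissonLaplace X (ENNReal.ofReal lam • volume) P) {r : ℝ} (hr : 0 < r) :
    ∫⁻ ω, expNeg (∑' i, ENNReal.ofReal (Real.log (1 + relativeGain β z r (X i ω)))) ∂P =
      expNeg (ENNReal.ofReal (lam * (Real.pi * r ^ 2 * gainIntegral β z))) := by
  have hm : Measurable fun y : Plane => ENNReal.ofReal (Real.log (1 + relativeGain β z r y)) :=
    (measurable_log_relativeGain β z).comp measurable_prodMk_left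
  rw [h _ hm, lintegral_smul_measure, lintegral_one_sub_expNeg_relativeGain hβ hz hr,
    smul_eq_mul, ← ENNReal.ofReal_mul hlam.le]

/-- The upper approximation of `R` in the grid of mesh `1 / (n + 1)`. -/
noncomputable def gridCeil (n : ℕ) (R : ℝ) : ℝ := ⌈R * (n + 1)⌉₊ / (n + 1)

lemma measurable_gridCeil (n : ℕ) : Measurable (gridCeil n) := by
  unfold gridCeil
  fun_prop

lemma le_gridCeil (n : ℕ) (R : ℝ) : R ≤ gridCeil n R := by
  rw [gridCeil, le_div_iff₀ (by positivity)]
  exact Nat.le_ceil _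

lemma tendsto_gridCeil {R : ℝ} (hR : 0 ≤ R) : Tendsto (fun n => gridCeil n R) atTop (𝓝 R) := by
  refine tendsto_of_tendsto_of_tendsto_of_le_of_le tendsto_const_nhds
    (h := fun n : ℕ => R + 1 / ((n : ℝ) + 1)) ?_ (fun n => le_gridCeil n R) fun n => ?_
  · simpa using (tendsto_one_div_add_atTop_nhds_zero_nat (𝕜 := ℝ)).const_add R
  · have := Nat.ceil_lt_add_one (show 0 ≤ R * ((n : ℝ) + 1) by positivity)
    simp only [gridCeil]
    rw [div_le_iff₀ (by positivity), add_mul, one_div_mul_cancel (by positivity)]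
    exact this.le

/-- On each grid ring the rounded radius is constant and, being rounded up, is the outer radius of
the ring. The gain thus ignores all points up to that radius, and the ring identity factors the
integral. -/
lemma HasPoissonLaplace.lintegral_coverage_gridCeil [IsProbabilityMeasure P]
    (hlam : 0 < lam) (hβ : 2 < β) (hz : 0 < z)
    (h : HasPoissonLaplace X (ENNReal.ofReal lam • volume) P) (hX : ∀ i, Measurable (X i))
    (n : ℕ) :
    ∫⁻ ω, coverage β σ z (gridCeil n (nearestDist fun i => X i ω)) (fun i => X i ω) ∂P =
      ∫⁻ ω, meanCoverage lam β σ z (gridCeil n (nearestDist fun i => X i ω)) ∂P := by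
  have hreg := h.ae_isRegular hlam hβ hX
  let R : Ω → ℝ := fun ω => nearestDist fun i => X i ω
  have hR : Measurable R := measurable_nearestDist.comp (measurable_pi_lambda _ hX)
  let K : Ω → ℕ := fun ω => ⌈R ω * (n + 1)⌉₊
  have hK : Measurable K := Nat.measurable_ceil.comp (by fun_prop)
  have hn : (0 : ℝ) < n + 1 := by positivity
  have hsplit (f : Ω → ℝ≥0∞) : ∫⁻ ω, f ω ∂P = ∑' k, ∫⁻ ω in K ⁻¹' {k}, f ω ∂P := by
    rw [← lintegral_iUnion (fun k => hK (measurableSet_singleton k))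
      (fun i j hij => Disjoint.preimage _ (by simpa using hij)), ← preimage_iUnion,
      iUnion_of_singleton, preimage_univ, Measure.restrict_univ]
  rw [hsplit, hsplit]
  refine tsum_congr fun k => ?_
  have hcongr (f g : ℝ → Ω → ℝ≥0∞)
      (hfg : ∫⁻ ω in K ⁻¹' {k}, f (k / (n + 1)) ω ∂P = ∫⁻ ω in K ⁻¹' {k}, g (k / (n + 1)) ω ∂P) :
      ∫⁻ ω in K ⁻¹' {k}, f (gridCeil n (R ω)) ω ∂P =
        ∫⁻ ω in K ⁻¹' {k}, g (gridCeil n (R ω)) ω ∂P := by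
    have hv (ω : Ω) (hω : ω ∈ K ⁻¹' {k}) : gridCeil n (R ω) = k / (n + 1) := by
      have : K ω = k := hω
      rw [gridCeil, ← this]
    rw [setLIntegral_congr_fun (hK (measurableSet_singleton k)) (g := f (k / (n + 1)))
      (fun ω hω => by simp only [hv ω hω]), hfg]
    exact setLIntegral_congr_fun (hK (measurableSet_singleton k))
      (fun ω hω => by simp only [hv ω hω])
  refine hcongr (fun r ω => coverage β σ z r fun i => X i ω)
    (fun r _ => meanCoverage lam β σ z r) ?_
  rcases k with _ | k
  -- The index 0 would mean R ≤ 0, which has probability zero.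
  · have h0 : P (K ⁻¹' {0}) = 0 := by
      refine measure_eq_zero_iff_ae_notMem.mpr ?_
      filter_upwards [hreg] with ω hω hω'
      have h1 : R ω * (n + 1) ≤ 0 := Nat.ceil_eq_zero.mp hω'
      have h2 : 0 < R ω := hω.nearestDist_pos hβ
      exact absurd h1 (not_le.mpr (by positivity))
    rw [setLIntegral_measure_zero _ _ h0, setLIntegral_measure_zero _ _ h0]
  · have hset : K ⁻¹' {k + 1} = {ω | (k : ℝ) / (n + 1) < nearestDist (fun i => X i ω) ∧
        nearestDist (fun i => X i ω) ≤ ((k + 1 : ℕ) : ℝ) / (n + 1)} := by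
      ext ω
      simp only [K, R, mem_preimage, mem_singleton_iff, mem_ofPred_eq]
      rw [Nat.ceil_eq_iff (by simp), div_lt_iff₀ hn, le_div_iff₀ hn, Nat.add_sub_cancel]
    have hr : 0 < ((k + 1 : ℕ) : ℝ) / (n + 1) := by positivity
    have hm : Measurable fun y : Plane => ENNReal.ofReal
        (Real.log (1 + relativeGain β z (((k + 1 : ℕ) : ℝ) / (n + 1)) y)) :=
      (measurable_log_relativeGain β z).comp measurable_prodMk_left
    have key := h.setLIntegral_annulus hX hreg hβ (a := (k : ℝ) / (n + 1))
      (b := ((k + 1 : ℕ) : ℝ) / (n + 1)) (by gcongr; simp) hm fun y hy => by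
        simp only [relativeGain, if_neg (not_lt.mpr hy), add_zero, Real.log_one,
          ENNReal.ofReal_zero]
    rw [← hset, h.lintegral_coverage_const hlam hβ hz hr] at key
    simp only [coverage]
    rw [lintegral_const_mul' _ _ (expNeg_ne_top _), key, lintegral_const, meanCoverage,
      Measure.restrict_apply_univ]
    ring

/-- Refining the grid replaces conditioning on the nearest distance; all integrands are bounded by
1. -/
lemma HasPoissonLaplace.lintegral_coverage [IsProbabilityMeasure P]
    (hlam : 0 < lam) (hβ : 2 < β) (hz : 0 < z)
    (h : HasPoissonLaplace X (ENNReal.ofReal lam • volume) P) (hX : ∀ i, Measurable (X i)) :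
    ∫⁻ ω, coverage β σ z (nearestDist fun i => X i ω) (fun i => X i ω) ∂P =
      ∫⁻ ω, meanCoverage lam β σ z (nearestDist fun i => X i ω) ∂P := by
  have hreg := h.ae_isRegular hlam hβ hX
  have hXm : Measurable fun ω i => X i ω := measurable_pi_lambda _ hX
  have hR : Measurable fun ω => nearestDist fun i => X i ω := measurable_nearestDist.comp hXm
  have hcm := (continuous_meanCoverage (lam := lam) (σ := σ) (z := z) hβ)
  have hmn (n : ℕ) : Measurable fun ω => coverage β σ z
      (gridCeil n (nearestDist fun i => X i ω)) (fun i => X i ω) :=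
    measurable_coverage ((measurable_gridCeil n).comp hR) hXm
  have h1 : Tendsto (fun n => ∫⁻ ω, coverage β σ z
      (gridCeil n (nearestDist fun i => X i ω)) (fun i => X i ω) ∂P) atTop
      (𝓝 (∫⁻ ω, coverage β σ z (nearestDist fun i => X i ω) (fun i => X i ω) ∂P)) := by
    refine tendsto_lintegral_of_dominated_convergence (fun _ => 1)
      hmn
      (fun n => Eventually.of_forall fun ω => coverage_le_one _ _ _ _ _) (by simp) ?_
    filter_upwards [hreg] with ω hω
    have hpos := hω.nearestDist_pos hβ
    exact hω.tendsto_coverage hβ hz hpos (fun n => le_gridCeil n _) (tendsto_gridCeil hpos.le)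
  have h2 : Tendsto (fun n => ∫⁻ ω, meanCoverage lam β σ z
      (gridCeil n (nearestDist fun i => X i ω)) ∂P) atTop
      (𝓝 (∫⁻ ω, meanCoverage lam β σ z (nearestDist fun i => X i ω) ∂P)) := by
    refine tendsto_lintegral_of_dominated_convergence (fun _ => 1)
      (fun n => hcm.measurable.comp ((measurable_gridCeil n).comp hR))
      (fun n => Eventually.of_forall fun ω => mul_le_one' (expNeg_le_one _) (expNeg_le_one _))
      (by simp) (Eventually.of_forall fun ω => ?_)
    exact (hcm.tendsto _).comp (tendsto_gridCeil (nearestDist_nonneg _))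
  exact tendsto_nhds_unique h1 (h2.congr fun n =>
    (h.lintegral_coverage_gridCeil hlam hβ hz hX n).symm)

/-- The disc of radius √(c/(πλ)) has intensity c, hence is empty with probability exp(-c). -/
lemma HasPoissonLaplace.map_nearestDist_sq [IsProbabilityMeasure P]
    (hlam : 0 < lam) (hβ : 2 < β)
    (h : HasPoissonLaplace X (ENNReal.ofReal lam • volume) P) (hX : ∀ i, Measurable (X i)) :
    P.map (fun ω => Real.pi * lam * (nearestDist fun i => X i ω) ^ 2) = expMeasure 1 := by
  have hreg := h.ae_isRegular hlam hβ hX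
  have hR : Measurable fun ω => nearestDist fun i => X i ω :=
    measurable_nearestDist.comp (measurable_pi_lambda _ hX)
  have hW : Measurable fun ω => Real.pi * lam * (nearestDist fun i => X i ω) ^ 2 := by fun_prop
  have hprob : IsProbabilityMeasure (expMeasure 1) := isProbabilityMeasure_expMeasure one_pos
  have hprob' := Measure.isProbabilityMeasure_map (μ := P) hW.aemeasurable
  have hpl : 0 < Real.pi * lam := mul_pos Real.pi_pos hlam
  have hnn (c : ℝ) (hc : 0 ≤ c) : P.map (fun ω => Real.pi * lam *
      (nearestDist fun i => X i ω) ^ 2) (Ioi c) = expMeasure 1 (Ioi c) := by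
    have hset : (fun ω => Real.pi * lam * (nearestDist fun i => X i ω) ^ 2) ⁻¹' Ioi c =
        {ω | Real.sqrt (c / (Real.pi * lam)) < nearestDist fun i => X i ω} := by
      ext ω
      rw [mem_preimage, mem_Ioi, mem_ofPred_eq, Real.sqrt_lt (by positivity) (nearestDist_nonneg _),
        div_lt_iff₀' hpl]
    rw [Measure.map_apply hW measurableSet_Ioi, hset, h.measure_lt_nearestDist hX hreg hβ,
      expMeasure_Ioi hc, ← expNeg_ofReal hc, Measure.smul_apply,
      EuclideanSpace.volume_closedBall_fin_two, ← ENNReal.ofReal_pow (Real.sqrt_nonneg _),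
      Real.sq_sqrt (by positivity), smul_eq_mul,
      ← ENNReal.ofReal_mul (by positivity), ← ENNReal.ofReal_mul (by positivity)]
    congr 2
    field_simp
  have hIoi (c : ℝ) : P.map (fun ω => Real.pi * lam *
      (nearestDist fun i => X i ω) ^ 2) (Ioi c) = expMeasure 1 (Ioi c) := by
    rcases le_or_gt 0 c with hc | hc
    · exact hnn c hc
    · have hone (μ : Measure ℝ) [IsProbabilityMeasure μ] (hμ : μ (Ioi 0) = expMeasure 1 (Ioi 0)) :
          μ (Ioi c) = 1 := by
        refine le_antisymm prob_le_one (le_trans (le_of_eq ?_)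
          (measure_mono (Ioi_subset_Ioi hc.le)))
        rw [hμ, expMeasure_Ioi le_rfl]
        simp
      rw [hone _ (hnn 0 le_rfl), hone _ rfl]
  refine Measure.ext_of_Iic _ _ fun c => ?_
  rw [← compl_Ioi, prob_compl_eq_one_sub measurableSet_Ioi,
    prob_compl_eq_one_sub measurableSet_Ioi, hIoi]

lemma HasPoissonLaplace.lintegral_coverage_eq_rho [IsProbabilityMeasure P]
    (hlam : 0 < lam) (hβ : 2 < β) (hz : 0 < z)
    (h : HasPoissonLaplace X (ENNReal.ofReal lam • volume) P) (hX : ∀ i, Measurable (X i)) :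
    ∫⁻ ω, coverage β σ z (nearestDist fun i => X i ω) (fun i => X i ω) ∂P =
      ∫⁻ w in Ioi 0, ENNReal.ofReal (rho lam β σ z w) := by
  have hR : Measurable fun ω => nearestDist fun i => X i ω :=
    measurable_nearestDist.comp (measurable_pi_lambda _ hX)
  have hA := gainIntegral_nonneg hβ hz
  rw [h.lintegral_coverage hlam hβ hz hX, lintegral_rho hlam hβ hz,
    ← h.map_nearestDist_sq hlam hβ hX, lintegral_map (by fun_prop) (by fun_prop)]
  refine lintegral_congr fun ω => ?_
  have hnn := nearestDist_nonneg fun i => X i ω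
  have hpl : 0 < Real.pi * lam := mul_pos Real.pi_pos hlam
  rw [mul_div_cancel_left₀ _ hpl.ne', meanCoverage, ← expNeg_add,
    ← ENNReal.ofReal_add (by positivity) (by have := Real.pi_pos; positivity)]
  congr 2
  have hpow : ((nearestDist fun i => X i ω) ^ 2) ^ (β / 2) = (nearestDist fun i => X i ω) ^ β := by
    rw [← Real.rpow_two, ← Real.rpow_mul hnn, mul_div_cancel₀ _ two_ne_zero]
  rw [hpow]
  ring

end Coverage

/-! ### Measurability of the nearest index and the SINR -/

section Measurability

variable {β σ : ℝ}

lemma measurableSet_isNearest (u : Plane) (i : ℕ) : MeasurableSet {x | IsNearest x u i} := by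
  have : {x | IsNearest x u i} =
      ⋂ j, ⋂ (_ : j ≠ i), {x : ℕ → Plane | ‖x i - u‖ < ‖x j - u‖} := by
    ext x
    simp only [IsNearest, mem_iInter, mem_ofPred_eq]
  rw [this]
  exact MeasurableSet.iInter fun j => MeasurableSet.iInter fun _ =>
    measurableSet_lt (by fun_prop) (by fun_prop)

lemma measurable_nearestIndex (u : Plane) : Measurable fun x => nearestIndex x u := by
  refine measurable_to_countable' fun n => ?_
  have hE : MeasurableSet {x | ∃ i, IsNearest x u i} := by
    have : {x | ∃ i, IsNearest x u i} = ⋃ i, {x | IsNearest x u i} := by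
      ext x
      simp only [mem_iUnion, mem_ofPred_eq]
    rw [this]
    exact MeasurableSet.iUnion fun i => measurableSet_isNearest u i
  have h0 (x : ℕ → Plane) (hx : ¬ ∃ i, IsNearest x u i) : nearestIndex x u = 0 := by
    have : {i | IsNearest x u i} = ∅ := by
      ext i
      simpa using fun hi => hx ⟨i, hi⟩
    rw [nearestIndex, this, Nat.sInf_empty]
  -- Configurations without a nearest point carry the default index 0, hence belong to the preimage
  -- exactly when n = 0.
  have : (fun x => nearestIndex x u) ⁻¹' {n} =
      {x | IsNearest x u n} ∪ ({x | ∃ i, IsNearest x u i}ᶜ ∩ {_x | n = 0}) := by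
    ext x
    constructor
    · intro hx
      have hx' : nearestIndex x u = n := hx
      by_cases he : ∃ i, IsNearest x u i
      · obtain ⟨i, hi⟩ := he
        rw [hi.nearestIndex_eq] at hx'
        exact Or.inl (hx' ▸ hi)
      · exact Or.inr ⟨he, (hx'.symm.trans (h0 x he) : n = 0)⟩
    · rintro (hx | ⟨he, hn⟩)
      · exact IsNearest.nearestIndex_eq hx
      · exact (h0 x he).trans (hn : n = 0).symm
  rw [this]
  exact (measurableSet_isNearest u n).union (hE.compl.inter (MeasurableSet.const _))

/-- The signal-to-interference-plus-noise ratio at the origin, when served by the nearest base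
station. -/
noncomputable def nearestSinr (β σ : ℝ) (x : ℕ → Plane) (h : ℕ → ℝ) : ℝ :=
  sinr β σ x h 0 (nearestIndex x 0)

lemma measurable_nearestSinr (β σ : ℝ) :
    Measurable fun p : (ℕ → Plane) × (ℕ → ℝ) => nearestSinr β σ p.1 p.2 := by
  have hi (i : ℕ) : Measurable fun p : (ℕ → Plane) × (ℕ → ℝ) => sinr β σ p.1 p.2 0 i := by
    have hr (j : ℕ) : Measurable fun p : (ℕ → Plane) × (ℕ → ℝ) =>
        receivedPower β p.1 p.2 0 j := by
      unfold receivedPower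
      fun_prop
    unfold sinr
    refine (hr i).div (Measurable.add_const ?_ _)
    unfold interference
    exact Measurable.tsum fun j => hr j
  have h : Measurable fun q : ℕ × ((ℕ → Plane) × (ℕ → ℝ)) => sinr β σ q.2.1 q.2.2 0 q.1 :=
    measurable_from_prod_countable_right hi
  have h' : Measurable fun p : (ℕ → Plane) × (ℕ → ℝ) => (nearestIndex p.1 0, p) :=
    ((measurable_nearestIndex 0).comp measurable_fst).prodMk measurable_id
  exact h.comp h'

end Measurability

/-! ### Rate of a user at the origin -/

section Static

variable {Ω : Type*} [MeasurableSpace Ω] {P : Measure Ω} [IsProbabilityMeasure P]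
  {lam β σ : ℝ} {X : ℕ → Ω → Plane} {h : ℕ → Ω → ℝ}

lemma measure_prodMk_mem_of_indepFun {α γ : Type*} [MeasurableSpace α] [MeasurableSpace γ]
    {f : Ω → α} {g : Ω → γ} (hf : Measurable f) (hg : Measurable g) (hfg : IndepFun f g P)
    {S : Set (α × γ)} (hS : MeasurableSet S) :
    P {ω | (f ω, g ω) ∈ S} = ∫⁻ ω, P {ω' | (f ω, g ω') ∈ S} ∂P := by
  have hprod := (indepFun_iff_map_prod_eq_prod_map_map hf.aemeasurable hg.aemeasurable).mp hfg
  have hpg := Measure.isProbabilityMeasure_map (μ := P) hg.aemeasurable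
  have h1 : P {ω | (f ω, g ω) ∈ S} = P.map (fun ω => (f ω, g ω)) S :=
    (Measure.map_apply (hf.prodMk hg) hS).symm
  rw [h1, hprod, Measure.prod_apply hS, lintegral_map (measurable_measure_prodMk_left hS) hf]
  exact lintegral_congr fun ω => Measure.map_apply hg (measurable_prodMk_left hS)

/-- Convergence of the interference for almost every fading is known for each regular configuration;
Fubini over the independent pair makes it an almost sure statement. -/
lemma ae_isRegular_and_fading (hlam : 0 < lam) (hβ : 2 < β)
    (hP : HasPoissonLaplace X (ENNReal.ofReal lam • volume) P) (hX : ∀ i, Measurable (X i))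
    (hm : ∀ i, Measurable (h i)) (hh : ∀ i, HasLaw (h i) (expMeasure 1) P)
    (hXh : IndepFun (fun ω i => X i ω) (fun ω i => h i ω) P) :
    ∀ᵐ ω ∂P, IsRegular β (fun i => X i ω) ∧ (∀ j, 0 < h j ω) ∧
      Summable fun j => h j ω * ‖X j ω‖ ^ (-β) := by
  have hreg := hP.ae_isRegular hlam hβ hX
  let S : Set ((ℕ → Plane) × (ℕ → ℝ)) :=
    {p | ∑' j, ENNReal.ofReal (p.2 j * ‖p.1 j‖ ^ (-β)) = ∞}
  have hS : MeasurableSet S := by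
    have hmeas : Measurable fun p : (ℕ → Plane) × (ℕ → ℝ) =>
        ∑' j, ENNReal.ofReal (p.2 j * ‖p.1 j‖ ^ (-β)) := Measurable.tsum fun j => by fun_prop
    exact hmeas (measurableSet_singleton ∞)
  have h0 := measure_prodMk_mem_of_indepFun (measurable_pi_lambda _ hX)
    (measurable_pi_lambda _ hm) hXh hS
  have h1 : ∫⁻ ω, P {ω' | ((fun i => X i ω), (fun i => h i ω')) ∈ S} ∂P = 0 := by
    rw [lintegral_congr_ae (g := fun _ => 0), lintegral_zero]
    filter_upwards [hreg] with ω hω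
    refine measure_eq_zero_iff_ae_notMem.mpr ?_
    filter_upwards [ae_fading hm hh hω hβ] with ω' hω' hmem
    exact hω'.2.tsum_ofReal_ne_top hmem
  rw [h1] at h0
  have hpos : ∀ᵐ ω ∂P, ∀ j, 0 < h j ω :=
    ae_all_iff.mpr fun j => ae_pos_of_hasLaw_expMeasure (hh j)
  filter_upwards [hreg, hpos, measure_eq_zero_iff_ae_notMem.mp h0] with ω h2 h3 h4
  refine ⟨h2, h3, (ENNReal.summable_toReal (fun h5 => h4 h5)).congr fun j =>
    ENNReal.toReal_ofReal ?_⟩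
  have := (h3 j).le
  positivity

lemma measure_lt_nearestSinr (hlam : 0 < lam) (hβ : 2 < β)
    (hP : HasPoissonLaplace X (ENNReal.ofReal lam • volume) P) (hX : ∀ i, Measurable (X i))
    (hm : ∀ i, Measurable (h i)) (hh : ∀ i, HasLaw (h i) (expMeasure 1) P)
    (hind : iIndepFun h P) (hXh : IndepFun (fun ω i => X i ω) (fun ω i => h i ω) P)
    {z : ℝ} (hz : 0 < z) :
    P {ω | z < nearestSinr β σ (fun i => X i ω) (fun i => h i ω)} =
      ∫⁻ w in Ioi 0, ENNReal.ofReal (rho lam β σ z w) := by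
  have hS : MeasurableSet {p : (ℕ → Plane) × (ℕ → ℝ) | z < nearestSinr β σ p.1 p.2} :=
    measurableSet_lt measurable_const (measurable_nearestSinr β σ)
  rw [← hP.lintegral_coverage_eq_rho hlam hβ hz hX]
  refine (measure_prodMk_mem_of_indepFun (measurable_pi_lambda _ hX)
    (measurable_pi_lambda _ hm) hXh hS).trans (lintegral_congr_ae ?_)
  filter_upwards [hP.ae_isRegular hlam hβ hX] with ω hω
  obtain ⟨b, hb⟩ := hω.exists_isNearest hβ
  have := measure_lt_sinr (σ := σ) hm hh hind hω hβ hb hz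
  rw [expNeg_add, ← hb.nearestDist_eq] at this
  rw [coverage, ← this, ← hb.nearestIndex_eq]
  rfl

lemma integral_one_div_one_add {s : ℝ} (hs : 0 ≤ s) :
    ∫ t in (0 : ℝ)..s, 1 / (1 + t) = Real.log (1 + s) := by
  rw [intervalIntegral.integral_comp_add_left (fun x => 1 / x) 1,
    integral_one_div_of_pos (by norm_num) (by linarith)]
  simp

/-- The layer-cake formula with weight 1/(1+t), the derivative of log(1+t). -/
lemma lintegral_log_one_add_nearestSinr (hlam : 0 < lam) (hβ : 2 < β)
    (hP : HasPoissonLaplace X (ENNReal.ofReal lam • volume) P) (hX : ∀ i, Measurable (X i))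
    (hm : ∀ i, Measurable (h i)) (hh : ∀ i, HasLaw (h i) (expMeasure 1) P)
    (hind : iIndepFun h P) (hXh : IndepFun (fun ω i => X i ω) (fun ω i => h i ω) P)
    (hnn : ∀ᵐ ω ∂P, 0 ≤ nearestSinr β σ (fun i => X i ω) (fun i => h i ω)) :
    ∫⁻ ω, ENNReal.ofReal (Real.log
      (1 + nearestSinr β σ (fun i => X i ω) (fun i => h i ω))) ∂P =
      ENNReal.ofReal (rateIntegral lam β σ) := by
  have hmeas : Measurable fun ω => nearestSinr β σ (fun i => X i ω) (fun i => h i ω) :=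
    (measurable_nearestSinr β σ).comp
      ((measurable_pi_lambda _ hX).prodMk (measurable_pi_lambda _ hm))
  have hlc := lintegral_comp_eq_lintegral_meas_lt_mul P (g := fun t => 1 / (1 + t)) hnn
    hmeas.aemeasurable (fun t ht => by
      refine ContinuousOn.intervalIntegrable fun s hs => ?_
      rw [uIcc_of_le ht.le] at hs
      have : 1 + s ≠ 0 := by linarith [hs.1]
      exact ContinuousAt.continuousWithinAt (by fun_prop (disch := assumption)))
    (by
      filter_upwards [self_mem_ae_restrict measurableSet_Ioi] with t ht
      have : (0 : ℝ) < t := ht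
      positivity)
  rw [ofReal_rateIntegral hlam hβ]
  calc _ = ∫⁻ ω, ENNReal.ofReal (∫ t in (0 : ℝ)..nearestSinr β σ (fun i => X i ω)
            (fun i => h i ω), 1 / (1 + t)) ∂P := by
        refine lintegral_congr_ae ?_
        filter_upwards [hnn] with ω hω
        rw [integral_one_div_one_add hω]
    _ = _ := hlc
    _ = _ := setLIntegral_congr_fun measurableSet_Ioi fun z hz => by
        rw [measure_lt_nearestSinr hlam hβ hP hX hm hh hind hXh hz]

/-- The rate of a user at the origin. -/
theorem HasPoissonLaplace.nearestDataRate_zero (hlam : 0 < lam) (hβ : 2 < β)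
    (hP : HasPoissonLaplace X (ENNReal.ofReal lam • volume) P) (hX : ∀ i, Measurable (X i))
    (hm : ∀ i, Measurable (h i)) (hh : ∀ i, HasLaw (h i) (expMeasure 1) P)
    (hind : iIndepFun h P) (hXh : IndepFun (fun ω i => X i ω) (fun ω i => h i ω) P) :
    (∀ᵐ ω ∂P, IsWellPosed β σ (fun i => X i ω) (fun i => h i ω) 0) ∧
      Integrable (fun ω => nearestDataRate β σ (fun i => X i ω) (fun i => h i ω) 0) P ∧
      ∫ ω, nearestDataRate β σ (fun i => X i ω) (fun i => h i ω) 0 ∂P =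
        rateIntegral lam β σ := by
  have hae := ae_isRegular_and_fading hlam hβ hP hX hm hh hXh
  have hnn : ∀ᵐ ω ∂P, 0 ≤ nearestSinr β σ (fun i => X i ω) (fun i => h i ω) := by
    filter_upwards [hae] with ω ⟨h1, h2, h3⟩
    have h4 := (interference_pos h1 h2 h3 (nearestIndex (fun i => X i ω) 0)).le
    have h5 := (h2 (nearestIndex (fun i => X i ω) 0)).le
    rw [nearestSinr, sinr, receivedPower_zero]
    positivity
  have hlog : ∀ᵐ ω ∂P, 0 ≤ nearestDataRate β σ (fun i => X i ω) (fun i => h i ω) 0 := by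
    filter_upwards [hnn] with ω hω
    exact Real.log_nonneg (le_add_of_nonneg_right hω)
  have hmeas : Measurable fun ω => nearestDataRate β σ (fun i => X i ω) (fun i => h i ω) 0 :=
    (((measurable_nearestSinr β σ).comp ((measurable_pi_lambda _ hX).prodMk
      (measurable_pi_lambda _ hm))).const_add 1).log
  have hL := lintegral_log_one_add_nearestSinr hlam hβ hP hX hm hh hind hXh hnn
  refine ⟨?_, ⟨hmeas.aestronglyMeasurable, ?_⟩, ?_⟩
  · filter_upwards [hae] with ω hω
    exact hω.1.isWellPosed hβ hω.2.1 hω.2.2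
  · rw [hasFiniteIntegral_iff_ofReal hlog]
    exact hL.trans_lt ENNReal.ofReal_lt_top
  · rw [integral_eq_lintegral_of_nonneg_ae hlog hmeas.aestronglyMeasurable]
    refine (congrArg ENNReal.toReal hL).trans (ENNReal.toReal_ofReal ?_)
    exact setIntegral_nonneg measurableSet_Ioi fun w _ =>
      setIntegral_nonneg measurableSet_Ioi fun z hz => rho_div_nonneg lam β σ w hz

end Static

/-! ### Moving the user to the origin -/

section Translation

variable {β σ : ℝ}

lemma receivedPower_sub (β : ℝ) (x : ℕ → Plane) (h : ℕ → ℝ) (u : Plane) :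
    receivedPower β (fun i => x i - u) h 0 = receivedPower β x h u := by
  funext i
  rw [receivedPower, receivedPower, sub_zero]

lemma isNearest_sub (x : ℕ → Plane) (u : Plane) :
    IsNearest (fun i => x i - u) 0 = IsNearest x u := by
  funext i
  simp only [IsNearest, sub_zero]

lemma nearestIndex_sub (x : ℕ → Plane) (u : Plane) :
    nearestIndex (fun i => x i - u) 0 = nearestIndex x u := by
  rw [nearestIndex, isNearest_sub, nearestIndex]

lemma interference_sub (β : ℝ) (x : ℕ → Plane) (h : ℕ → ℝ) (u : Plane) :
    interference β (fun i => x i - u) h 0 = interference β x h u := by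
  funext i
  rw [interference, receivedPower_sub, interference]

lemma isWellPosed_sub (β σ : ℝ) (x : ℕ → Plane) (h : ℕ → ℝ) (u : Plane) :
    IsWellPosed β σ (fun i => x i - u) h 0 ↔ IsWellPosed β σ x h u := by
  rw [IsWellPosed, isNearest_sub, receivedPower_sub, interference_sub, nearestIndex_sub,
    IsWellPosed]

lemma nearestDataRate_sub (β σ : ℝ) (x : ℕ → Plane) (h : ℕ → ℝ) (u : Plane) :
    nearestDataRate β σ (fun i => x i - u) h 0 = nearestDataRate β σ x h u := by
  rw [nearestDataRate, dataRate, sinr, receivedPower_sub, interference_sub, nearestIndex_sub,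
    nearestDataRate, dataRate, sinr]

lemma measurable_location (s t : ℕ) : Measurable fun y : ℕ → Plane => location s y t := by
  unfold location
  fun_prop

end Translation

/-- Equal expectations make every time average with m > 0 equal to T. -/
lemma HasExpectedDataRate.of_integral_eq {Ω : Type*} [MeasurableSpace Ω] {P : Measure Ω}
    {ξ : ℕ → Ω → ℝ} {T : ℝ} (hint : ∀ t, Integrable (ξ t) P) (hT : ∀ t, ∫ ω, ξ t ω ∂P = T) :
    HasExpectedDataRate P ξ T := by
  refine ⟨hint, tendsto_const_nhds.congr' ?_⟩
  filter_upwards [eventually_gt_atTop 0] with m hm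
  rw [integral_finsetSum _ fun t _ => hint t]
  simp only [hT, Finset.sum_const, Finset.card_range, nsmul_eq_mul]
  have : (m : ℝ) ≠ 0 := by positivity
  field_simp

end CellularNetwork

/-! ### The moving user and the static user -/

open CellularNetwork in
/-- `X` are the base stations, `H i t` is the fading of base station `i` at slot `t`, `Y k` is the
displacement of the user in its cycle number `k` of `s` slots. The numbering of the base stations
may depend on the motion of the user; only the point process itself has to be independent of it. -/
theorem proposition1 {Ω : Type*} [MeasurableSpace Ω] (P : Measure Ω) [IsProbabilityMeasure P]
    (lam β σ : ℝ) (hlam : 0 < lam) (hβ : 2 < β) (s : ℕ) (hs : 0 < s)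
    (X : ℕ → Ω → Plane) (H : ℕ → ℕ → Ω → ℝ) (Y : ℕ → Ω → Plane)
    (hXm : ∀ i, Measurable (X i)) (hHm : ∀ i t, Measurable (H i t))
    (hYm : ∀ k, Measurable (Y k))
    (hPoisson : IsPoissonPointProcess (fun ω => pointMeasure fun i => X i ω)
      (ENNReal.ofReal lam • (volume : Measure Plane)) P)
    (hHexp : ∀ i t, HasLaw (H i t) (expMeasure 1) P)
    (hHindep : iIndepFun (fun p : ℕ × ℕ => H p.1 p.2) P)
    (hYindep : iIndepFun Y P) (hYident : ∀ k, IdentDistrib (Y k) (Y 0) P P)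
    (hindepY : IndepFun (fun ω => pointMeasure fun i => X i ω) (fun ω k => Y k ω) P)
    (hindepH : IndepFun (fun ω => ((fun i => X i ω), (fun k => Y k ω)))
      (fun ω (p : ℕ × ℕ) => H p.1 p.2 ω) P) :
    -- at every slot, the rate of the moving user is almost surely well defined
    (∀ t, ∀ᵐ ω ∂P, IsWellPosed β σ (fun i => X i ω) (fun i => H i t ω)
      (location s (fun k => Y k ω) t)) ∧
    -- the integrals in the formula converge
    (∀ z : ℝ, 0 < z → IntegrableOn (fun v : ℝ => v ^ (2 / β - 1) / (1 + v)) (Ioi (1 / z))) ∧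
    IntegrableOn (fun p : ℝ × ℝ => rho lam β σ p.1 p.2 / (1 + p.1)) (Ioi 0 ×ˢ Ioi 0) ∧
    -- the moving user, always served by its nearest base station
    HasExpectedDataRate P
      (fun t ω => nearestDataRate β σ (fun i => X i ω) (fun i => H i t ω)
        (location s (fun k => Y k ω) t))
      (rateIntegral lam β σ) ∧
    -- a static user, at any location and any slot
    (∀ (u : Plane) (t : ℕ),
      Integrable (fun ω => nearestDataRate β σ (fun i => X i ω) (fun i => H i t ω) u) P ∧
      ∫ ω, nearestDataRate β σ (fun i => X i ω) (fun i => H i t ω) u ∂P =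
        rateIntegral lam β σ) := by
  -- One statement serves both users: g is `location s · t` for the moving user and a constant for
  -- the static one.
  have key (g : (ℕ → Plane) → Plane) (hg : Measurable g) (t : ℕ) :
      (∀ᵐ ω ∂P, IsWellPosed β σ (fun i => X i ω) (fun i => H i t ω) (g fun k => Y k ω)) ∧
      Integrable (fun ω => nearestDataRate β σ (fun i => X i ω) (fun i => H i t ω)
        (g fun k => Y k ω)) P ∧
      ∫ ω, nearestDataRate β σ (fun i => X i ω) (fun i => H i t ω) (g fun k => Y k ω) ∂P =
        rateIntegral lam β σ := by
    have hU : Measurable fun ω => g fun k => Y k ω := hg.comp (measurable_pi_lambda _ hYm)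
    have hΦU : IndepFun (fun ω => pointMeasure fun i => X i ω) (fun ω => g fun k => Y k ω) P :=
      hindepY.comp measurable_id hg
    have hsf : SigmaFinite (ENNReal.ofReal lam • (volume : Measure Plane)) :=
      inferInstanceAs (SigmaFinite (lam.toNNReal • (volume : Measure Plane)))
    have hφ : Measurable fun p : (ℕ → Plane) × (ℕ → Plane) => fun i => p.1 i - g p.2 :=
      measurable_pi_lambda _ fun i => by fun_prop
    have hψ : Measurable fun (q : ℕ × ℕ → ℝ) (i : ℕ) => q (i, t) :=
      measurable_pi_lambda _ fun i => by fun_prop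
    have hXh : IndepFun (fun ω i => X i ω - g fun k => Y k ω) (fun ω i => H i t ω) P :=
      hindepH.comp hφ hψ
    have hinj : Function.Injective fun i : ℕ => (i, t) := fun i j hij => congrArg Prod.fst hij
    have hstatic := (hPoisson.hasPoissonLaplace_sub hU hΦU).nearestDataRate_zero (σ := σ) hlam hβ
      (fun i => (hXm i).sub hU) (fun i => hHm i t) (fun i => hHexp i t)
      (hHindep.precomp hinj) hXh
    simpa only [isWellPosed_sub, nearestDataRate_sub] using hstatic
  refine ⟨fun t => (key _ (measurable_location s t) t).1,
    fun z hz => integrableOn_rpow_div_one_add hβ (by positivity),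
    integrableOn_rho_div hlam hβ,
    HasExpectedDataRate.of_integral_eq (fun t => (key _ (measurable_location s t) t).2.1)
      (fun t => (key _ (measurable_location s t) t).2.2),
    fun u t => (key (fun _ => u) measurable_const t).2⟩
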